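/- **Theorem (asymptotic normality of the local-linear RD estimator, $d=2$, $p=1$).** Let $(R_i,Y_i)_{i\ge1}$ be i.i.d. random vectors with $R_i=(R_{i,1},R_{i,2})\in\mathbb R^2$ and $Y_i\in\mathbb R$. Let $\mathcal T\subseteq\mathbb R^2$ be the (measurable) treatment region and $\mathcal T^C$ the complement of its closure, the control region. Let $c=(c_1,c_2)$ and let $U$ be an open neighbourhood of $c$. Assume the following. 1. *Design.* $R_i$ has a probability density $f$ that is continuous on $U$, with $f(c)>0$. The boundary of $\mathcal T$ is linear near $c$: for some $\delta>0$, $\mathcal T\cap\prod_{j=1}^2[c_j-\delta,c_j+\delta]=[c_1-\delta,c_1+\delta]\times[c_2,c_2+\delta]$, where the points of the boundary line $\{z_2=c_2\}$ may or may not be counted as belonging to $\mathcal T$. 2. *Kernel.* $K:\mathbb R^2\to[0,\infty)$ is measurable, bounded and supported on $[-C_K,C_K]^2$ for some $C_K>0$. With $K_+(z)=K(z)1\{z_2\ge0\}$ and $K_-(z)=K(z)1\{z_2<0\}$ one has $\int K_\pm(z)\,dz=1$, and the $3\times3$ matrices $S_\pm=\int K_\pm(z)\,(1,z_1,z_2)'(1,z_1,z_2)\,dz$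 are non-singular. 3. *Regression.* $Y_i=m_+(R_i)+\varepsilon_{+,i}$ with $E[\varepsilon_{+,i}\mid R_i]=0$ for $R_i\in\mathcal T$, and $Y_i=m_-(R_i)+\varepsilon_{-,i}$ with $E[\varepsilon_{-,i}\mid R_i]=0$ for $R_i\in\mathcal T^C$. The functions $m_+$ and $m_-$ are twice continuously differentiable on $U$. The conditional variances $\sigma_\pm^2(z)=E[\varepsilon_{\pm,i}^2\mid R_i=z]$ (with $z\in\mathcal T\cap U$ for $+$ and $z\in\mathcal T^C\cap U$ for $-$) are continuous at $c$, the values $\sigma^2_\pm(c)$ being the limits at $c$ from the respective side. For some $\delta'>0$ the conditional moments $E[|\varepsilon_{\pm,i}|^{2+\delta'}\mid R_i=z]$ are bounded over these $z$. 4. *Bandwidths.* $h_j=h_{j,n}>0$ $(j=1,2)$ and, as $n\to\infty$: $h_j\to0$ and $nh_1h_2h_j^2\to\infty$ for $j=1,2$; and $nh_1h_2h_j^2h_k^2\to c_{jk}$ for some $c_{jk}\in[0,\infty)$, for $1\le j\le k\le2$. Let $\hat\beta^+(c)=(\hat\beta_0^+(c),\hat\beta_1^+(c),\hat\beta_2^+(c))'$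 be a (measurable) minimizer over $\beta\in\mathbb R^3$ of $$\sum_{i=1}^n\bigl(Y_i-\beta_0-\beta_1(R_{i,1}-c_1)-\beta_2(R_{i,2}-c_2)\bigr)^2K\Bigl(\tfrac{R_{i,1}-c_1}{h_1},\tfrac{R_{i,2}-c_2}{h_2}\Bigr)1\{R_i\in\mathcal T\},$$ and let $\hat\beta^-(c)$ be the same with $\mathcal T^C$ in place of $\mathcal T$. Put $e_1=(1,0,0)'$, $$B_\pm=\int K_\pm(z)\begin{pmatrix}1\\z_1\\z_2\end{pmatrix}(z_1^2,\;z_1z_2,\;z_2^2)\,dz,\qquad \mathcal K_\pm=\int K_\pm^2(z)\begin{pmatrix}1\\z_1\\z_2\end{pmatrix}(1,z_1,z_2)\,dz,$$ $$M_{\pm,n}=\Bigl(\tfrac{\partial_{11}m_\pm(c)}2h_1^2,\;\partial_{12}m_\pm(c)\,h_1h_2,\;\tfrac{\partial_{22}m_\pm(c)}2h_2^2\Bigr)'.$$ Then, as $n\to\infty$, $$\sqrt{nh_1h_2}\,\Bigl[\bigl(\hat\beta_0^+(c)-\hat\beta_0^-(c)\bigr)-\bigl(m_+(c)-m_-(c)\bigr)-e_1'\bigl\{S_+^{-1}B_+M_{+,n}-S_-^{-1}B_-M_{-,n}\bigr\}\Bigr]$$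 converges in distribution to $N(0,V)$ with $$V=e_1'\Bigl\{\frac{\sigma_+^2(c)}{f(c)}S_+^{-1}\mathcal K_+S_+^{-1}+\frac{\sigma_-^2(c)}{f(c)}S_-^{-1}\mathcal K_-S_-^{-1}\Bigr\}e_1$$ (in particular $V\ge0$; if $V=0$ the limit is the point mass at $0$). -/

import Mathlib

open MeasureTheory ProbabilityTheory Filter Topology

namespace RD

/-- Points of the plane; coordinate `0` is the first running variable, coordinate `1` the second. -/
abbrev Plane : Type := Fin 2 → ℝ

/-! ### Kernel moments -/

/-- The vector `(1, z₁, z₂)'`. -/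
def lin (z : Plane) : Fin 3 → ℝ := ![1, z 0, z 1]

/-- The vector `(z)₂ = (z₁², z₁ z₂, z₂²)'`. -/
def quad (z : Plane) : Fin 3 → ℝ := ![z 0 ^ 2, z 0 * z 1, z 1 ^ 2]

open Classical in
/-- `K₊(z) = K(z) 1{z₂ ≥ 0}`. -/
noncomputable def kerPos (K : Plane → ℝ) (z : Plane) : ℝ := if 0 ≤ z 1 then K z else 0

open Classical in
/-- `K₋(z) = K(z) 1{z₂ < 0}`. -/
noncomputable def kerNeg (K : Plane → ℝ) (z : Plane) : ℝ := if z 1 < 0 then K z else 0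

/-- `S = ∫ k(z) (1, z₁, z₂)' (1, z₁, z₂) dz`. -/
noncomputable def momS (k : Plane → ℝ) : Matrix (Fin 3) (Fin 3) ℝ :=
  Matrix.of fun i j => ∫ z : Plane, k z * (lin z i * lin z j)

/-- `𝒦 = ∫ k(z)² (1, z₁, z₂)' (1, z₁, z₂) dz`. -/
noncomputable def momK (k : Plane → ℝ) : Matrix (Fin 3) (Fin 3) ℝ :=
  Matrix.of fun i j => ∫ z : Plane, k z ^ 2 * (lin z i * lin z j)

/-- `B = ∫ k(z) (1, z₁, z₂)' (z₁², z₁ z₂, z₂²) dz`. -/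
noncomputable def momB (k : Plane → ℝ) : Matrix (Fin 3) (Fin 3) ℝ :=
  Matrix.of fun i j => ∫ z : Plane, k z * (lin z i * quad z j)

/-- Regularity of the kernel `K : ℝ² → [0, ∞)`. -/
structure KernelRegular (K : Plane → ℝ) : Prop where
  measurable : Measurable K
  nonneg : ∀ z, 0 ≤ K z
  integral_pos : ∫ z : Plane, kerPos K z = 1
  integral_neg : ∫ z : Plane, kerNeg K z = 1
  bounded : ∃ b : ℝ, ∀ z, K z ≤ b
  support : ∃ C : ℝ, 0 < C ∧ ∀ z, (∃ j, C < |z j|) → K z = 0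
  nonsing_pos : IsUnit (momS (kerPos K)).det
  nonsing_neg : IsUnit (momS (kerNeg K)).det

/-! ### Derivatives of the regression functions and the bias vector -/

/-- The partial derivative `∂ⱼ g` (used for differentiable `g` only). -/
noncomputable def pderiv (j : Fin 2) (g : Plane → ℝ) (x : Plane) : ℝ :=
  fderiv ℝ g x (Pi.single j 1)

/-- `(∂₁₁m(c) h₁²/2, ∂₁₂m(c) h₁h₂, ∂₂₂m(c) h₂²/2)'`. -/
noncomputable def biasVec (m : Plane → ℝ) (c h : Plane) : Fin 3 → ℝ :=
  ![pderiv 0 (pderiv 0 m) c / 2 * h 0 ^ 2,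
    pderiv 0 (pderiv 1 m) c * (h 0 * h 1),
    pderiv 1 (pderiv 1 m) c / 2 * h 1 ^ 2]

/-- The second-order bias term `e₁' S⁻¹ B (∂₁₁m(c) h₁²/2, ∂₁₂m(c) h₁h₂, ∂₂₂m(c) h₂²/2)'`. -/
noncomputable def biasTerm (k : Plane → ℝ) (m : Plane → ℝ) (c h : Plane) : ℝ :=
  (((momS k)⁻¹ * momB k).mulVec (biasVec m c h)) 0

/-! ### Design, sample and regression model -/

/-- The control region: the complement of the closure of the treatment region. -/
def control (T : Set Plane) : Set Plane := (closure T)ᶜ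

/-- Near `c` the treatment region is the half-plane `{z₂ ≥ c₂}`; whether the points of the
boundary line `z₂ = c₂` themselves are treated is left open. -/
def LocallyHalfPlane (T : Set Plane) (c : Plane) : Prop :=
  ∃ δ : ℝ, 0 < δ ∧ ∀ z : Plane, (∀ j, |z j - c j| ≤ δ) →
    (c 1 < z 1 → z ∈ T) ∧ (z ∈ T → c 1 ≤ z 1)

/-- `(Rᵢ, Yᵢ)`, `i = 0, 1, 2, …`, is an i.i.d. sequence of random vectors. -/
structure IIDSample {Ω : Type*} [MeasurableSpace Ω] (P : Measure Ω)
    (R : ℕ → Ω → Plane) (Y : ℕ → Ω → ℝ) : Prop where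
  measurable_R : ∀ i, Measurable (R i)
  measurable_Y : ∀ i, Measurable (Y i)
  indep : iIndepFun (fun i ω => (R i ω, Y i ω)) P
  ident : ∀ i, IdentDistrib (fun ω => (R i ω, Y i ω)) (fun ω => (R 0 ω, Y 0 ω)) P P

/-- The law `ρ` on the plane has Lebesgue density `f`, continuous on the neighbourhood `U` of `c`
and positive at `c`. -/
structure DensityRegular (ρ : Measure Plane) (f : Plane → ℝ) (U : Set Plane) (c : Plane) :
    Prop where
  measurable : Measurable f
  nonneg : ∀ z, 0 ≤ f z
  law : ρ = volume.withDensity (fun z => ENNReal.ofReal (f z))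
  continuousOn : ContinuousOn f U
  pos : 0 < f c

/-- The regression model on one side. Here `ρ` is the law of the running variables, `κ z` the
conditional law of the outcome given that they equal `z`, and `A` the region (treatment or
control). The error is `ε = Y - m(R)`, so `E[g(ε) | R = z] = ∫ g (y - m z) κ(z, dy)`. -/
structure SideRegular (ρ : Measure Plane) (κ : Kernel Plane ℝ) (A U : Set Plane) (c : Plane)
    (m v : Plane → ℝ) : Prop where
  mean : ∀ᵐ z ∂ρ, z ∈ A → Integrable (fun y : ℝ => y) (κ z) ∧ ∫ y, (y - m z) ∂(κ z) = 0
  smooth : ContDiffOn ℝ 2 m U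
  variance : ∀ᵐ z ∂ρ, z ∈ A ∩ U → ∫ y, (y - m z) ^ 2 ∂(κ z) = v z
  variance_cont : ContinuousWithinAt v A c
  moment : ∃ δ : ℝ, 0 < δ ∧ ∃ C : ℝ, ∀ᵐ z ∂ρ, z ∈ A ∩ U →
    ∫⁻ y, ENNReal.ofReal (|y - m z| ^ (2 + δ)) ∂(κ z) ≤ ENNReal.ofReal C

/-- Bandwidth rates for `d = 2`, `p = 1`. -/
structure BandwidthRates (h : ℕ → Plane) : Prop where
  pos : ∀ n j, 0 < h n j
  tendsto_zero : ∀ j, Tendsto (fun n => h n j) atTop (𝓝 0)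
  rate_lower : ∀ j,
    Tendsto (fun n : ℕ => (n : ℝ) * h n 0 * h n 1 * h n j ^ 2) atTop atTop
  rate_upper : ∀ j k, j ≤ k → ∃ a : ℝ, 0 ≤ a ∧
    Tendsto (fun n : ℕ => (n : ℝ) * h n 0 * h n 1 * (h n j ^ 2 * h n k ^ 2)) atTop (𝓝 a)

/-! ### The local-linear estimator -/

open Classical in
/-- The kernel-weighted least squares criterion
`∑ᵢ (yᵢ - β₀ - β₁ (rᵢ₁ - c₁) - β₂ (rᵢ₂ - c₂))² K((rᵢ₁ - c₁)/h₁, (rᵢ₂ - c₂)/h₂) 1{rᵢ ∈ A}`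
over the first `n` observations. -/
noncomputable def criterion (K : Plane → ℝ) (A : Set Plane) (c h : Plane) (n : ℕ)
    (r : ℕ → Plane) (y : ℕ → ℝ) (β : Fin 3 → ℝ) : ℝ :=
  ∑ i ∈ Finset.range n,
    (y i - β 0 - β 1 * (r i 0 - c 0) - β 2 * (r i 1 - c 1)) ^ 2 *
      K (fun j => (r i j - c j) / h j) * (if r i ∈ A then 1 else 0)

/-- `β n` is, for every `n`, a local-linear estimator from the first `n` observations in `A`:
a random vector that minimizes the criterion (which minimizer is chosen is left open on the event
where there are several). -/
structure IsLocalLinear {Ω : Type*} [MeasurableSpace Ω] (P : Measure Ω)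
    (R : ℕ → Ω → Plane) (Y : ℕ → Ω → ℝ) (K : Plane → ℝ) (A : Set Plane) (c : Plane)
    (h : ℕ → Plane) (β : ℕ → Ω → Fin 3 → ℝ) : Prop where
  aemeasurable : ∀ n, AEMeasurable (β n) P
  isMin : ∀ n, ∀ᵐ ω ∂P, ∀ b : Fin 3 → ℝ,
    criterion K A c (h n) n (fun i => R i ω) (fun i => Y i ω) (β n ω) ≤
      criterion K A c (h n) n (fun i => R i ω) (fun i => Y i ω) b

/-- The asymptotic variance
`e₁' {σ₊²(c)/f(c) S₊⁻¹ 𝒦₊ S₊⁻¹ + σ₋²(c)/f(c) S₋⁻¹ 𝒦₋ S₋⁻¹} e₁`. -/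
noncomputable def asympVar (K : Plane → ℝ) (f vPos vNeg : Plane → ℝ) (c : Plane) : ℝ :=
  ((vPos c / f c) • ((momS (kerPos K))⁻¹ * momK (kerPos K) * (momS (kerPos K))⁻¹) +
    (vNeg c / f c) • ((momS (kerNeg K))⁻¹ * momK (kerNeg K) * (momS (kerNeg K))⁻¹)) 0 0

end RD

/-!
# Asymptotic normality of the local-linear regression-discontinuity estimator

Write `Z = (R - c)/h` for the rescaled running variable and `N = n h₁ h₂` for the effective sample
size. On each side of the cutoff the kernel weights with the region indicator coincide, for small
bandwidths and almost surely, with a one-sided kernel `k(Z)`. The normal equations of the weighted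
least squares problem then say that `θ = √N (γ - S⁻¹ B u)`, with `γ` the error of the coefficients
multiplied by `(1, h₁, h₂)` and `u` the vector of second-order Taylor terms, solves `Sₙ θ = Dₙ`
(`normal_equations_rescaled`). Here `Sₙ` is the Gram matrix of kernel averages, and `Dₙ` is the sum
`Wₙ` of the mean-zero scores `N^{-1/2} k(Z) (1, Z₁, Z₂) (Y - m(R))` plus two error terms: a Taylor
remainder, and `(Bₙ - Sₙ S⁻¹ B) √N u`, where `√N u` is bounded by the bandwidth rates.

Kernel averages converge in mean square to `f(c) ∫ φ` (`isSmallOp_kernelAvg_sub`), by a change of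
variables and continuity of the density. Hence both errors are `o_p(1)` and `Sₙ → f(c) S`. The
matrix `Sₙ`, which may be singular, is never inverted: the identity
`θ - F⁻¹ Wₙ = F⁻¹ (Dₙ - Wₙ) + F⁻¹ (F - Sₙ) θ` with `F = f(c) S` has a small factor in front of `θ`
that can be absorbed (`IsSmallOp.of_le_add_mul`). This gives `θ = F⁻¹ Wₙ + o_p(1)` for every
choice of minimizer (`isSmallOp_coefError_sub`).

The difference of the two intercepts is therefore, up to `o_p(1)`, a row sum of a triangular array
with i.i.d. rows, to which a central limit theorem applies
(`tendstoInDistribution_sum_triangular`). The two one-sided kernels have disjoint supports, so the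
variance is the sum of the one-sided variances. These converge by continuity of the conditional
variance at `c` (`tendsto_score_variance`), and the negligibility condition follows from the
conditional moments of order `2 + δ` (`tendsto_score_truncated`).
-/

namespace RD

/-! ### A central limit theorem for row-wise i.i.d. triangular arrays -/

lemma norm_cexp_sub_taylor_two_le (x : ℝ) :
    ‖Complex.exp (x * Complex.I) - 1 - x * Complex.I + x ^ 2 / 2‖ ≤
      4 * min (x ^ 2) (|x| ^ 3) := by
  rcases le_total |x| 1 with hx | hx
  · have h := Complex.norm_exp_sub_sum_le_norm_mul_exp (x * Complex.I) 3
    have e : Complex.exp (x * Complex.I) - ∑ m ∈ Finset.range 3,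
        (x * Complex.I : ℂ) ^ m / (m.factorial : ℂ) =
        Complex.exp (x * Complex.I) - 1 - x * Complex.I + x ^ 2 / 2 := by
      simp [Finset.sum_range_succ, mul_pow, Nat.factorial]
      ring
    rw [e] at h
    have hn : ‖(x * Complex.I : ℂ)‖ = |x| := by simp
    rw [hn] at h
    have h3 : |x| ^ 3 ≤ x ^ 2 := by
      rw [← sq_abs x, pow_succ]
      exact mul_le_of_le_one_right (by positivity) hx
    rw [min_eq_right h3]
    have he : Real.exp |x| ≤ 4 := by
      have := Real.exp_le_exp.2 hx
      have := Real.exp_one_lt_d9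
      linarith
    calc _ ≤ |x| ^ 3 * Real.exp |x| := h
      _ ≤ |x| ^ 3 * 4 := by gcongr
      _ = _ := by ring
  · have h3 : x ^ 2 ≤ |x| ^ 3 := by
      rw [← sq_abs x, pow_succ _ 2]
      exact le_mul_of_one_le_right (by positivity) hx
    rw [min_eq_left h3]
    have h1 : ‖Complex.exp (x * Complex.I)‖ = 1 := Complex.norm_exp_ofReal_mul_I x
    have h2 : ‖(x * Complex.I : ℂ)‖ = |x| := by simp
    have h4 : ‖(x ^ 2 / 2 : ℂ)‖ = |x| ^ 2 / 2 := by simp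
    have h5 : |x| ≤ x ^ 2 := by
      rw [← sq_abs x, sq]
      exact le_mul_of_one_le_right (by positivity) hx
    have h6 : |x| ^ 2 = x ^ 2 := sq_abs x
    calc _ ≤ ‖Complex.exp (x * Complex.I)‖ + ‖(1 : ℂ)‖ + ‖(x * Complex.I : ℂ)‖ +
          ‖(x ^ 2 / 2 : ℂ)‖ := by
          refine (norm_add_le _ _).trans ?_
          gcongr
          refine (norm_sub_le _ _).trans ?_
          gcongr
          exact norm_sub_le _ _
      _ ≤ 4 * x ^ 2 := by rw [h1, h2, h4, norm_one, h6]; nlinarith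

lemma min_sq_cube_mul_le (t x : ℝ) :
    min ((t * x) ^ 2) (|t * x| ^ 3) ≤ (t ^ 2 + |t| ^ 3) * min (x ^ 2) (|x| ^ 3) := by
  rcases le_total (x ^ 2) (|x| ^ 3) with h | h
  · rw [min_eq_left h]
    refine (min_le_left _ _).trans ?_
    rw [mul_pow]
    gcongr
    have : 0 ≤ |t| ^ 3 := by positivity
    linarith
  · rw [min_eq_right h]
    refine (min_le_right _ _).trans ?_
    rw [abs_mul, mul_pow]
    gcongr
    have : 0 ≤ t ^ 2 := by positivity
    linarith

lemma norm_charFun_sub_le {E : Type*} [MeasurableSpace E] (μ : Measure E) [IsProbabilityMeasure μ]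
    {g : E → ℝ} (hg : Measurable g) (h2 : MemLp g 2 μ) (h0 : ∫ x, g x ∂μ = 0) (t : ℝ) :
    ‖charFun (μ.map g) t - (1 - ((t ^ 2 / 2 * ∫ x, g x ^ 2 ∂μ : ℝ) : ℂ))‖ ≤
      4 * (t ^ 2 + |t| ^ 3) * ∫ x, min (g x ^ 2) (|g x| ^ 3) ∂μ := by
  have hi1 : Integrable g μ := h2.integrable (by norm_num)
  have hi2 : Integrable (fun x => g x ^ 2) μ := h2.integrable_sq
  have hie : Integrable (fun x => Complex.exp (((t * g x : ℝ) : ℂ) * Complex.I)) μ := by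
    refine Integrable.of_bound (C := 1) (by fun_prop) (ae_of_all _ fun x => ?_)
    rw [Complex.norm_exp_ofReal_mul_I]
  have him : Integrable (fun x => min (g x ^ 2) (|g x| ^ 3)) μ := by
    refine hi2.mono' (by fun_prop) (ae_of_all _ fun x => ?_)
    rw [Real.norm_of_nonneg (by positivity)]
    exact min_le_left _ _
  have hc : charFun (μ.map g) t = ∫ x, Complex.exp (((t * g x : ℝ) : ℂ) * Complex.I) ∂μ := by
    rw [charFun_apply_real, integral_map hg.aemeasurable (by fun_prop)]
    simp
  have key : charFun (μ.map g) t - (1 - ((t ^ 2 / 2 * ∫ x, g x ^ 2 ∂μ : ℝ) : ℂ)) =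
      ∫ x, (Complex.exp (((t * g x : ℝ) : ℂ) * Complex.I) - 1 - ((t * g x : ℝ) : ℂ) * Complex.I
        + ((t * g x : ℝ) : ℂ) ^ 2 / 2) ∂μ := by
    have i1 : Integrable (fun x => ((t * g x : ℝ) : ℂ) * Complex.I) μ :=
      ((hi1.const_mul t).ofReal).mul_const _
    have i2 : Integrable (fun x => ((t * g x : ℝ) : ℂ) ^ 2 / 2) μ := by
      have : Integrable (fun x => (((t ^ 2 / 2) * g x ^ 2 : ℝ) : ℂ)) μ :=
        (hi2.const_mul (t ^ 2 / 2)).ofReal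
      refine this.congr (ae_of_all _ fun x => ?_)
      push_cast; ring
    have e1 : ∫ x, ((t * g x : ℝ) : ℂ) * Complex.I ∂μ = 0 := by
      rw [integral_mul_const, integral_complex_ofReal, integral_const_mul, h0]; simp
    have e2 : ∫ x, ((t * g x : ℝ) : ℂ) ^ 2 / 2 ∂μ = ((t ^ 2 / 2 * ∫ x, g x ^ 2 ∂μ : ℝ) : ℂ) := by
      rw [← integral_const_mul, ← integral_complex_ofReal]
      congr 1; ext x; push_cast; ring
    have i3 : Integrable (fun x => Complex.exp (((t * g x : ℝ) : ℂ) * Complex.I) - 1) μ :=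
      hie.sub (integrable_const 1)
    have i4 : Integrable (fun x => Complex.exp (((t * g x : ℝ) : ℂ) * Complex.I) - 1
        - ((t * g x : ℝ) : ℂ) * Complex.I) μ := i3.sub i1
    rw [integral_add i4 i2, integral_sub i3 i1, integral_sub hie (integrable_const 1),
      e1, e2, hc]
    simp
    ring
  rw [key, ← integral_const_mul]
  refine norm_integral_le_of_norm_le (him.const_mul _) (ae_of_all _ fun x => ?_)
  refine (norm_cexp_sub_taylor_two_le (t * g x)).trans ?_
  have := min_sq_cube_mul_le t (g x)
  nlinarith

/-- **Central limit theorem for triangular arrays with i.i.d. rows.** The `n`-th row is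
`g n (ξ i)`, `i < n`, for one i.i.d. sequence `ξ`. The truncated-moment condition
`n E min(g², |g|³) → 0` follows from Lyapunov's condition for any exponent and is what a
second-order expansion of the characteristic function needs. -/
theorem tendstoInDistribution_sum_triangular {Ω E : Type*} [MeasurableSpace Ω] [MeasurableSpace E]
    {P : Measure Ω} [IsProbabilityMeasure P] {ξ : ℕ → Ω → E} (hξ : ∀ i, Measurable (ξ i))
    (hind : iIndepFun ξ P) {μ : Measure E} [IsProbabilityMeasure μ] (hlaw : ∀ i, P.map (ξ i) = μ)
    {g : ℕ → E → ℝ} (hg : ∀ n, Measurable (g n)) (h2 : ∀ᶠ n in atTop, MemLp (g n) 2 μ)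
    (h0 : ∀ᶠ n in atTop, ∫ x, g n x ∂μ = 0) {V : NNReal}
    (hV : Tendsto (fun n : ℕ => (n : ℝ) * ∫ x, g n x ^ 2 ∂μ) atTop (𝓝 V))
    (hL : Tendsto (fun n : ℕ => (n : ℝ) * ∫ x, min (g n x ^ 2) (|g n x| ^ 3) ∂μ) atTop (𝓝 0)) :
    TendstoInDistribution (fun (n : ℕ) ω => ∑ i ∈ Finset.range n, g n (ξ i ω)) atTop
      (id : ℝ → ℝ) (fun _ => P) (gaussianReal 0 V) where
  forall_aemeasurable n := by
    have := fun i => (hg n).comp (hξ i)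
    exact (Finset.measurable_sum _ fun i _ => this i).aemeasurable
  aemeasurable_limit := aemeasurable_id
  tendsto := by
    refine ProbabilityMeasure.tendsto_iff_tendsto_charFun.2 fun t => ?_
    have hcf : ∀ n : ℕ, charFun (P.map fun ω => ∑ i ∈ Finset.range n, g n (ξ i ω)) t =
        (1 + (charFun (μ.map (g n)) t - 1)) ^ n := by
      intro n
      have hi : iIndepFun (fun i ω => g n (ξ i ω)) P := hind.comp (fun _ => g n) (fun _ => hg n)
      rw [(hi.restrict _).charFun_map_fun_finsetSum_eq_prod
        (fun i _ => (by have := (hg n).comp (hξ i); exact this.aemeasurable :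
          AEMeasurable (fun ω => g n (ξ i ω)) P)), Finset.prod_apply]
      rw [Finset.prod_congr rfl (g := fun _ => charFun (μ.map (g n)) t)]
      · simp
      · intro i _
        rw [← hlaw i, Measure.map_map (hg n) (hξ i)]
        rfl
    simp only [ProbabilityMeasure.coe_mk, Measure.map_id, charFun_gaussianReal]
    simp_rw [hcf]
    refine Complex.tendsto_one_add_pow_exp_of_tendsto ?_
    have lim1 : Tendsto (fun n : ℕ => (((-(t ^ 2 / 2)) * ((n : ℝ) * ∫ x, g n x ^ 2 ∂μ) : ℝ) : ℂ))
        atTop (𝓝 (((-(t ^ 2 / 2)) * (V : ℝ) : ℝ) : ℂ)) :=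
      (Complex.continuous_ofReal.tendsto _).comp (hV.const_mul _)
    have lim2 : Tendsto (fun n : ℕ => (n : ℂ) * (charFun (μ.map (g n)) t -
        (1 - ((t ^ 2 / 2 * ∫ x, g n x ^ 2 ∂μ : ℝ) : ℂ)))) atTop (𝓝 0) := by
      have hb := hL.const_mul (4 * (t ^ 2 + |t| ^ 3))
      rw [mul_zero] at hb
      refine squeeze_zero_norm' ?_ hb
      filter_upwards [h2, h0] with n hn2 hn0
      rw [norm_mul, Complex.norm_natCast]
      refine (mul_le_mul_of_nonneg_left (norm_charFun_sub_le μ (hg n) hn2 hn0 t)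
        (Nat.cast_nonneg n)).trans_eq (by ring)
    have := lim2.add lim1
    convert this using 2
    · push_cast; ring
    · push_cast; simp; ring

/-! ### Second moments of averages -/

/-- Bias–variance bound for a sum of `n` i.i.d. terms. -/
lemma lintegral_sq_sum_sub_le {Ω E : Type*} [MeasurableSpace Ω] [MeasurableSpace E]
    {P : Measure Ω} [IsProbabilityMeasure P] {ξ : ℕ → Ω → E} (hξ : ∀ i, Measurable (ξ i))
    (hind : iIndepFun ξ P) {μ : Measure E} [IsProbabilityMeasure μ] (hlaw : ∀ i, P.map (ξ i) = μ)
    {g : E → ℝ} (hg : Measurable g) (h2 : MemLp g 2 μ) (n : ℕ) (a : ℝ) :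
    ∫⁻ ω, ENNReal.ofReal ((∑ i ∈ Finset.range n, g (ξ i ω) - a) ^ 2) ∂P ≤
      ENNReal.ofReal (n * ∫ x, g x ^ 2 ∂μ + (n * ∫ x, g x ∂μ - a) ^ 2) := by
  have hL : ∀ i, MemLp (fun ω => g (ξ i ω)) 2 P := fun i => by
    have : MemLp g 2 (P.map (ξ i)) := by rw [hlaw i]; exact h2
    exact this.comp_of_map (hξ i).aemeasurable
  have hi : iIndepFun (fun i ω => g (ξ i ω)) P := hind.comp (fun _ => g) (fun _ => hg)
  have hmean : ∀ i, ∫ ω, g (ξ i ω) ∂P = ∫ x, g x ∂μ := fun i => by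
    rw [← hlaw i, integral_map (hξ i).aemeasurable hg.aestronglyMeasurable]
  have hsq : ∀ i, ∫ ω, g (ξ i ω) ^ 2 ∂P = ∫ x, g x ^ 2 ∂μ := fun i => by
    rw [← hlaw i, integral_map (hξ i).aemeasurable (hg.pow_const 2).aestronglyMeasurable]
  set S : Ω → ℝ := fun ω => ∑ i ∈ Finset.range n, g (ξ i ω) with hS
  have hSL : MemLp S 2 P := memLp_finsetSum _ fun i _ => hL i
  have hSm : ∫ ω, S ω ∂P = n * ∫ x, g x ∂μ := by
    rw [hS, integral_finsetSum _ fun i _ => (hL i).integrable (by norm_num)]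
    simp [hmean]
  have hvar : Var[S; P] ≤ n * ∫ x, g x ^ 2 ∂μ := by
    have e : S = ∑ i ∈ Finset.range n, fun ω => g (ξ i ω) := by ext ω; simp [hS]
    rw [e, IndepFun.variance_sum (fun i _ => hL i) (fun i _ j _ hij => hi.indepFun hij)]
    calc _ ≤ ∑ i ∈ Finset.range n, ∫ x, g x ^ 2 ∂μ := by
          refine Finset.sum_le_sum fun i _ => ?_
          rw [← hsq i]
          exact variance_le_expectation_sq (hL i).1
      _ = _ := by simp
  have hSa : Integrable (fun ω => (S ω - a) ^ 2) P := (hSL.sub (memLp_const a)).integrable_sq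
  rw [← ofReal_integral_eq_lintegral_ofReal hSa (ae_of_all _ fun ω => sq_nonneg _)]
  refine ENNReal.ofReal_le_ofReal ?_
  have : ∫ ω, (S ω - a) ^ 2 ∂P = Var[S; P] + (∫ ω, S ω ∂P - a) ^ 2 := by
    have iS := hSL.integrable (by norm_num : (1 : ENNReal) ≤ 2)
    have iS2 := hSL.integrable_sq
    rw [variance_eq_sub hSL]
    have : ∀ ω, (S ω - a) ^ 2 = S ω ^ 2 - 2 * a * S ω + a ^ 2 := fun ω => by ring
    simp_rw [this]
    have i3 : Integrable (fun ω => S ω ^ 2 - 2 * a * S ω) P := iS2.sub (iS.const_mul _)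
    rw [integral_add i3 (integrable_const _), integral_sub iS2 (iS.const_mul _), integral_const_mul]
    simp
    ring
  rw [this, hSm]
  linarith

/-! ### Stochastic orders of magnitude -/

section StochasticOrder

variable {Ω : Type*} [MeasurableSpace Ω] {P : Measure Ω} {X Y D : ℕ → Ω → ℝ}

/-- `X n = o_p(1)`. Outer measure is used, so no measurability of `X n` is needed. -/
def IsSmallOp (P : Measure Ω) (X : ℕ → Ω → ℝ) : Prop :=
  ∀ ε : ℝ, 0 < ε → Tendsto (fun n => P {ω | ε < |X n ω|}) atTop (𝓝 0)

/-- `X n = O_p(1)`. -/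
def IsBigOp (P : Measure Ω) (X : ℕ → Ω → ℝ) : Prop :=
  ∀ ε : ENNReal, 0 < ε → ∃ M : ℝ, 0 < M ∧ ∀ᶠ n in atTop, P {ω | M < |X n ω|} ≤ ε

lemma IsSmallOp.mono (hY : IsSmallOp P Y)
    (h : ∀ᶠ n in atTop, ∀ᵐ ω ∂P, |X n ω| ≤ |Y n ω|) : IsSmallOp P X := by
  intro ε hε
  refine tendsto_of_tendsto_of_tendsto_of_le_of_le' tendsto_const_nhds (hY ε hε)
    (Eventually.of_forall fun _ => zero_le) ?_
  filter_upwards [h] with n hn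
  refine measure_mono_ae ?_
  filter_upwards [hn] with ω hω h1
  exact lt_of_lt_of_le h1 hω

lemma IsBigOp.mono (hY : IsBigOp P Y)
    (h : ∀ᶠ n in atTop, ∀ᵐ ω ∂P, |X n ω| ≤ |Y n ω|) : IsBigOp P X := by
  intro ε hε
  obtain ⟨M, hM, hb⟩ := hY ε hε
  refine ⟨M, hM, ?_⟩
  filter_upwards [h, hb] with n hn hb
  refine (measure_mono_ae ?_).trans hb
  filter_upwards [hn] with ω hω h1
  exact lt_of_lt_of_le h1 hω

lemma IsSmallOp.zero : IsSmallOp P (fun _ _ => 0) := by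
  intro ε hε
  simp [not_lt.2 hε.le]

lemma IsBigOp.zero : IsBigOp P (fun _ _ => 0) := by
  intro ε hε
  refine ⟨1, one_pos, Eventually.of_forall fun n => ?_⟩
  simp [not_lt.2 (zero_le_one' ℝ)]

lemma IsSmallOp.add (hX : IsSmallOp P X) (hY : IsSmallOp P Y) :
    IsSmallOp P (fun n ω => X n ω + Y n ω) := by
  intro ε hε
  have := (hX (ε / 2) (by positivity)).add (hY (ε / 2) (by positivity))
  rw [add_zero] at this
  refine tendsto_of_tendsto_of_tendsto_of_le_of_le tendsto_const_nhds this
    (fun _ => zero_le) fun n => ?_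
  refine (measure_mono fun ω hω => ?_).trans (measure_union_le _ _)
  by_contra hcon
  simp only [Set.mem_union, Set.mem_ofPred_eq, not_or, not_lt] at hcon hω
  have := abs_add_le (X n ω) (Y n ω)
  linarith

lemma IsBigOp.add (hX : IsBigOp P X) (hY : IsBigOp P Y) :
    IsBigOp P (fun n ω => X n ω + Y n ω) := by
  intro ε hε
  obtain ⟨M, hM, h1⟩ := hX (ε / 2) (ENNReal.half_pos hε.ne')
  obtain ⟨M', hM', h2⟩ := hY (ε / 2) (ENNReal.half_pos hε.ne')
  refine ⟨M + M', by positivity, ?_⟩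
  filter_upwards [h1, h2] with n h1 h2
  calc _ ≤ P ({ω | M < |X n ω|} ∪ {ω | M' < |Y n ω|}) := measure_mono fun ω hω => by
        by_contra hcon
        simp only [Set.mem_union, Set.mem_ofPred_eq, not_or, not_lt] at hcon hω
        have := abs_add_le (X n ω) (Y n ω)
        linarith
    _ ≤ ε / 2 + ε / 2 := (measure_union_le _ _).trans (add_le_add h1 h2)
    _ = ε := ENNReal.add_halves ε

lemma IsSmallOp.sum {ι : Type*} (s : Finset ι) {X : ι → ℕ → Ω → ℝ}
    (h : ∀ i ∈ s, IsSmallOp P (X i)) : IsSmallOp P (fun n ω => ∑ i ∈ s, X i n ω) := by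
  classical
  induction s using Finset.induction_on with
  | empty => simpa using IsSmallOp.zero
  | insert a s ha ih =>
    simp only [Finset.sum_insert ha]
    exact (h a (by simp)).add (ih fun i hi => h i (by simp [hi]))

lemma IsBigOp.sum {ι : Type*} (s : Finset ι) {X : ι → ℕ → Ω → ℝ}
    (h : ∀ i ∈ s, IsBigOp P (X i)) : IsBigOp P (fun n ω => ∑ i ∈ s, X i n ω) := by
  classical
  induction s using Finset.induction_on with
  | empty => simpa using IsBigOp.zero
  | insert a s ha ih =>
    simp only [Finset.sum_insert ha]
    exact (h a (by simp)).add (ih fun i hi => h i (by simp [hi]))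

lemma IsSmallOp.abs (hX : IsSmallOp P X) : IsSmallOp P (fun n ω => |X n ω|) :=
  hX.mono (Eventually.of_forall fun n => ae_of_all _ fun ω => by simp)

lemma IsSmallOp.isBigOp (hX : IsSmallOp P X) : IsBigOp P X := by
  intro ε hε
  exact ⟨1, one_pos, (hX 1 one_pos).eventually_le_const hε⟩

lemma IsSmallOp.mul_isBigOp (hX : IsSmallOp P X) (hY : IsBigOp P Y) :
    IsSmallOp P (fun n ω => X n ω * Y n ω) := by
  intro ε hε
  rw [ENNReal.tendsto_nhds_zero]
  intro e he
  obtain ⟨M, hM, h1⟩ := hY (e / 2) (ENNReal.half_pos he.ne')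
  have h2 := (hX (ε / M) (by positivity)).eventually_le_const (ENNReal.half_pos he.ne')
  filter_upwards [h1, h2] with n h1 h2
  calc _ ≤ P ({ω | ε / M < |X n ω|} ∪ {ω | M < |Y n ω|}) := measure_mono fun ω hω => by
        by_contra hcon
        simp only [Set.mem_union, Set.mem_ofPred_eq, not_or, not_lt] at hcon hω
        rw [abs_mul] at hω
        have : |X n ω| * |Y n ω| ≤ ε / M * M := by gcongr <;> [exact hcon.1; exact hcon.2]
        rw [div_mul_cancel₀ _ hM.ne'] at this
        linarith
    _ ≤ e / 2 + e / 2 := (measure_union_le _ _).trans (add_le_add h2 h1)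
    _ = e := ENNReal.add_halves e

lemma isBigOp_of_bounded {b : ℕ → ℝ} (hb : ∃ B : ℝ, ∀ᶠ n in atTop, |b n| ≤ B) :
    IsBigOp P (fun n _ => b n) := by
  obtain ⟨B, hB⟩ := hb
  intro ε hε
  refine ⟨max B 1, by positivity, ?_⟩
  filter_upwards [hB] with n hn
  simp [not_lt.2 (hn.trans (le_max_left B 1))]

lemma measure_abs_gt_le_of_sq {X : Ω → ℝ} (hX : Measurable X) {b : ℝ}
    (h : ∫⁻ ω, ENNReal.ofReal (X ω ^ 2) ∂P ≤ ENNReal.ofReal b) {ε : ℝ} (hε : 0 < ε) :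
    P {ω | ε < |X ω|} ≤ ENNReal.ofReal (b / ε ^ 2) := by
  have h1 : ENNReal.ofReal (ε ^ 2) * P {ω | ε < |X ω|} ≤ ENNReal.ofReal b := by
    refine le_trans ?_ h
    refine le_trans ?_ (mul_meas_ge_le_lintegral (by fun_prop) (ENNReal.ofReal (ε ^ 2)))
    gcongr
    intro hlt
    rw [← sq_abs (X _)]
    exact ENNReal.ofReal_le_ofReal (pow_le_pow_left₀ hε.le (le_of_lt hlt) 2)
  rw [ENNReal.ofReal_div_of_pos (by positivity)]
  rwa [ENNReal.le_div_iff_mul_le (by simp [hε.ne']) (by simp), mul_comm]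

lemma isSmallOp_of_sq (hX : ∀ n, Measurable (X n)) {b : ℕ → ℝ} (hb : Tendsto b atTop (𝓝 0))
    (h : ∀ᶠ n in atTop, ∫⁻ ω, ENNReal.ofReal (X n ω ^ 2) ∂P ≤ ENNReal.ofReal (b n)) :
    IsSmallOp P X := by
  intro ε hε
  have hb' : Tendsto (fun n => ENNReal.ofReal (b n / ε ^ 2)) atTop (𝓝 0) := by
    have := ENNReal.tendsto_ofReal (hb.div_const (ε ^ 2))
    simpa using this
  refine tendsto_of_tendsto_of_tendsto_of_le_of_le' tendsto_const_nhds hb'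
    (Eventually.of_forall fun _ => zero_le) ?_
  filter_upwards [h] with n hn
  exact measure_abs_gt_le_of_sq (hX n) hn hε

/-- Bounded second moments imply tightness, by Chebyshev's inequality. -/
lemma isBigOp_of_sq (hX : ∀ n, Measurable (X n)) {b : ℝ}
    (h : ∀ᶠ n in atTop, ∫⁻ ω, ENNReal.ofReal (X n ω ^ 2) ∂P ≤ ENNReal.ofReal b) :
    IsBigOp P X := by
  intro ε hε
  have hlim : Tendsto (fun M : ℕ => ENNReal.ofReal (b / ((M : ℝ) + 1) ^ 2)) atTop (𝓝 0) := by
    have h1 : Tendsto (fun M : ℕ => b / ((M : ℝ) + 1) ^ 2) atTop (𝓝 0) :=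
      tendsto_const_nhds.div_atTop ((tendsto_pow_atTop two_ne_zero).comp
        (tendsto_natCast_atTop_atTop.atTop_add tendsto_const_nhds))
    simpa using ENNReal.tendsto_ofReal h1
  obtain ⟨M, hM⟩ := (hlim.eventually_le_const hε).exists
  refine ⟨M + 1, by positivity, ?_⟩
  filter_upwards [h] with n hn
  exact (measure_abs_gt_le_of_sq (hX n) hn (by positivity)).trans hM

/-- If `D` is bounded by a small amount plus a small multiple of itself and of a bounded quantity,
then `D` is small: on the likely event where the multiple is at most `1/2` it can be absorbed. -/
lemma IsSmallOp.of_le_add_mul {δ η : ℕ → Ω → ℝ} (hδ : IsSmallOp P δ) (hη : IsSmallOp P η)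
    (hY : IsBigOp P Y) (hY0 : ∀ n ω, 0 ≤ Y n ω) (hD0 : ∀ n ω, 0 ≤ D n ω)
    (h : ∀ᶠ n in atTop, ∀ᵐ ω ∂P, D n ω ≤ δ n ω + η n ω * (D n ω + Y n ω)) :
    IsSmallOp P D := by
  have hs : IsSmallOp P (fun n ω => |δ n ω| + |η n ω| * Y n ω) :=
    hδ.abs.add (hη.abs.mul_isBigOp hY)
  intro ε hε
  have h1 := (hs (ε / 2) (by positivity)).add (hη (1 / 2) (by positivity))
  rw [add_zero] at h1
  refine tendsto_of_tendsto_of_tendsto_of_le_of_le' tendsto_const_nhds h1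
    (Eventually.of_forall fun _ => zero_le) ?_
  filter_upwards [h] with n hn
  refine (measure_mono_ae ?_).trans (measure_union_le _ _)
  filter_upwards [hn] with ω hω h2
  by_contra hcon
  have h2 : ε < |D n ω| := h2
  have hcon : ¬ (ε / 2 < |(|δ n ω| + |η n ω| * Y n ω)| ∨ 1 / 2 < |η n ω|) := hcon
  simp only [not_or, not_lt] at hcon
  rw [abs_of_nonneg (hD0 n ω)] at h2
  have h3 := (le_abs_self _).trans hcon.1
  have h4 : η n ω * (D n ω + Y n ω) ≤ |η n ω| * (D n ω + Y n ω) :=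
    mul_le_mul_of_nonneg_right (le_abs_self _) (add_nonneg (hD0 n ω) (hY0 n ω))
  have h5 : |η n ω| * D n ω ≤ 1 / 2 * D n ω := mul_le_mul_of_nonneg_right hcon.2 (hD0 n ω)
  have h6 := le_abs_self (δ n ω)
  nlinarith

/-- A form of Slutsky's lemma. -/
lemma tendstoInDistribution_of_isSmallOp_sub [IsProbabilityMeasure P] {Ω' : Type*}
    [MeasurableSpace Ω'] {P' : Measure Ω'} [IsProbabilityMeasure P'] {Z : Ω' → ℝ}
    (hX : TendstoInDistribution X atTop Z (fun _ => P) P') (hY : ∀ n, AEMeasurable (Y n) P)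
    (h : IsSmallOp P (fun n ω => Y n ω - X n ω)) :
    TendstoInDistribution Y atTop Z (fun _ => P) P' := by
  refine tendstoInDistribution_of_tendstoInMeasure_sub Y Z hX ?_ hY
  rw [tendstoInMeasure_iff_dist]
  intro ε hε
  refine tendsto_of_tendsto_of_tendsto_of_le_of_le tendsto_const_nhds (h (ε / 2) (by positivity))
    (fun _ => zero_le) fun n => measure_mono fun ω hω => ?_
  have hω : ε ≤ dist (Y n ω - X n ω) 0 := hω
  change ε / 2 < |Y n ω - X n ω|
  rw [Real.dist_0_eq_abs] at hω
  linarith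

end StochasticOrder

/-! ### Weighted least squares -/

/-- The sum of the absolute values of the entries, a norm compatible with the sup norm. -/
def entrySum (M : Matrix (Fin 3) (Fin 3) ℝ) : ℝ := ∑ i, ∑ j, |M i j|

lemma entrySum_nonneg (M : Matrix (Fin 3) (Fin 3) ℝ) : 0 ≤ entrySum M :=
  Finset.sum_nonneg fun _ _ => Finset.sum_nonneg fun _ _ => abs_nonneg _

lemma norm_mulVec_le (M : Matrix (Fin 3) (Fin 3) ℝ) (v : Fin 3 → ℝ) :
    ‖M.mulVec v‖ ≤ entrySum M * ‖v‖ := by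
  refine (pi_norm_le_iff_of_nonneg (mul_nonneg (entrySum_nonneg M) (norm_nonneg v))).2 fun i => ?_
  have h1 : |M.mulVec v i| ≤ (∑ j, |M i j|) * ‖v‖ := by
    rw [Matrix.mulVec, dotProduct, Finset.sum_mul]
    refine (Finset.abs_sum_le_sum_abs _ _).trans (Finset.sum_le_sum fun j _ => ?_)
    rw [abs_mul]
    exact mul_le_mul_of_nonneg_left (norm_le_pi_norm v j) (abs_nonneg _)
  refine h1.trans (mul_le_mul_of_nonneg_right ?_ (norm_nonneg v))
  exact Finset.single_le_sum (f := fun i => ∑ j, |M i j|)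
    (fun i _ => Finset.sum_nonneg fun j _ => abs_nonneg _) (Finset.mem_univ i)

/-- Perturbation of a linear system: if `S θ = D`, then `θ` is close to `F⁻¹ W` when `S` is close
to `F` and `D` to `W`. -/
lemma norm_sub_inv_mulVec_le {F S : Matrix (Fin 3) (Fin 3) ℝ} (hF : IsUnit F.det)
    {θ D W : Fin 3 → ℝ} (h : S.mulVec θ = D) :
    ‖θ - F⁻¹.mulVec W‖ ≤ entrySum F⁻¹ * ‖D - W‖ +
      (entrySum F⁻¹ * entrySum (F - S)) * (‖θ - F⁻¹.mulVec W‖ + ‖F⁻¹.mulVec W‖) := by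
  have e : θ - F⁻¹.mulVec W = F⁻¹.mulVec (D - W) + F⁻¹.mulVec ((F - S).mulVec θ) := by
    have h1 : F⁻¹.mulVec (F.mulVec θ) = θ := by
      rw [Matrix.mulVec_mulVec, Matrix.nonsing_inv_mul _ hF, Matrix.one_mulVec]
    rw [Matrix.sub_mulVec, h, Matrix.mulVec_sub, Matrix.mulVec_sub, h1]
    abel
  have hθ : ‖θ‖ ≤ ‖θ - F⁻¹.mulVec W‖ + ‖F⁻¹.mulVec W‖ := by
    simpa using norm_add_le (θ - F⁻¹.mulVec W) (F⁻¹.mulVec W)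
  calc ‖θ - F⁻¹.mulVec W‖ = ‖F⁻¹.mulVec (D - W) + F⁻¹.mulVec ((F - S).mulVec θ)‖ := by rw [← e]
    _ ≤ entrySum F⁻¹ * ‖D - W‖ + entrySum F⁻¹ * (entrySum (F - S) * ‖θ‖) := by
        refine (norm_add_le _ _).trans (add_le_add (norm_mulVec_le _ _) ?_)
        exact (norm_mulVec_le _ _).trans
          (mul_le_mul_of_nonneg_left (norm_mulVec_le _ _) (entrySum_nonneg _))
    _ ≤ _ := by
        rw [← mul_assoc]
        gcongr
        exact mul_nonneg (entrySum_nonneg _) (entrySum_nonneg _)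

/-- The normal equations of weighted least squares. -/
lemma normal_equations {ι : Type*} (s : Finset ι) (w y : ι → ℝ) (x : ι → Fin 3 → ℝ)
    (β : Fin 3 → ℝ)
    (hmin : ∀ b : Fin 3 → ℝ, ∑ i ∈ s, w i * (y i - ∑ l, β l * x i l) ^ 2 ≤
      ∑ i ∈ s, w i * (y i - ∑ l, b l * x i l) ^ 2) (j : Fin 3) :
    ∑ i ∈ s, w i * x i j * (y i - ∑ l, β l * x i l) = 0 := by
  set G := ∑ i ∈ s, w i * x i j * (y i - ∑ l, β l * x i l) with hG
  set H := ∑ i ∈ s, w i * x i j ^ 2 with hH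
  -- the criterion is a quadratic polynomial in `t` along `β + t eⱼ`, minimal at `t = 0`
  have key : ∀ t : ℝ, 0 ≤ H * (t * t) + (-2 * G) * t + 0 := by
    intro t
    have h1 := hmin (β + t • Pi.single j 1)
    have h2 : ∀ i, ∑ l, (β + t • (Pi.single j 1 : Fin 3 → ℝ)) l * x i l =
        ∑ l, β l * x i l + t * x i j := by
      intro i
      simp [add_mul, Finset.sum_add_distrib, Pi.single_apply]
    simp_rw [h2] at h1
    have h3 : ∑ i ∈ s, w i * (y i - (∑ l, β l * x i l + t * x i j)) ^ 2 =
        ∑ i ∈ s, w i * (y i - ∑ l, β l * x i l) ^ 2 + (H * (t * t) + (-2 * G) * t) := by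
      rw [hG, hH, Finset.sum_mul, Finset.mul_sum, Finset.sum_mul, ← Finset.sum_add_distrib,
        ← Finset.sum_add_distrib]
      refine Finset.sum_congr rfl fun i _ => ?_
      ring
    rw [h3] at h1
    linarith
  have := discrim_le_zero key
  rw [discrim] at this
  have : G ^ 2 ≤ 0 := by nlinarith
  exact pow_eq_zero_iff two_ne_zero |>.1 (le_antisymm this (sq_nonneg G))

/-- The linear system solved by the rescaled estimation error `√N (γ - Q u)`, where `γ` is the
error of the rescaled coefficients, `u` the vector of second-order Taylor terms and `Q u` the
first-order bias. -/
lemma rescaled_normal_equations {ι : Type*} (s : Finset ι) (w e ρ : ι → ℝ)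
    (x q : ι → Fin 3 → ℝ) (γ u : Fin 3 → ℝ) (Q : Matrix (Fin 3) (Fin 3) ℝ) {N : ℝ} (hN : 0 < N)
    (hne : ∀ j, ∑ i ∈ s, w i * x i j * (e i + ρ i + ∑ l, q i l * u l - ∑ l, γ l * x i l) = 0) :
    (Matrix.of fun j l => (∑ i ∈ s, w i * (x i j * x i l)) / N).mulVec
        (√N • (γ - Q.mulVec u)) =
      (fun j => ∑ i ∈ s, (√N)⁻¹ * (w i * x i j) * e i) +
      (fun j => ∑ i ∈ s, (√N)⁻¹ * (w i * x i j) * ρ i) +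
      ((Matrix.of fun j l => (∑ i ∈ s, w i * (x i j * q i l)) / N) -
        (Matrix.of fun j l => (∑ i ∈ s, w i * (x i j * x i l)) / N) * Q).mulVec (√N • u) := by
  set S : Matrix (Fin 3) (Fin 3) ℝ := Matrix.of fun j l => (∑ i ∈ s, w i * (x i j * x i l)) / N
  set B : Matrix (Fin 3) (Fin 3) ℝ := Matrix.of fun j l => (∑ i ∈ s, w i * (x i j * q i l)) / N
  have hr : √N / N = (√N)⁻¹ := by
    rw [div_eq_iff hN.ne', ← div_eq_inv_mul, eq_div_iff (Real.sqrt_pos.2 hN).ne',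
      Real.mul_self_sqrt hN.le]
  have main : S.mulVec (√N • γ) =
      (fun j => ∑ i ∈ s, (√N)⁻¹ * (w i * x i j) * e i) +
      (fun j => ∑ i ∈ s, (√N)⁻¹ * (w i * x i j) * ρ i) + B.mulVec (√N • u) := by
    ext j
    have hS : S.mulVec (√N • γ) j =
        ∑ i ∈ s, (√N)⁻¹ * (w i * x i j * ∑ l, γ l * x i l) := by
      simp only [S, Matrix.mulVec, dotProduct, Matrix.of_apply, Pi.smul_apply, smul_eq_mul,
        Finset.mul_sum, Finset.sum_div, Finset.sum_mul]
      rw [Finset.sum_comm]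
      refine Finset.sum_congr rfl fun i _ => Finset.sum_congr rfl fun l _ => ?_
      rw [← hr]; ring
    have hB : B.mulVec (√N • u) j =
        ∑ i ∈ s, (√N)⁻¹ * (w i * x i j * ∑ l, q i l * u l) := by
      simp only [B, Matrix.mulVec, dotProduct, Matrix.of_apply, Pi.smul_apply, smul_eq_mul,
        Finset.mul_sum, Finset.sum_div, Finset.sum_mul]
      rw [Finset.sum_comm]
      refine Finset.sum_congr rfl fun i _ => Finset.sum_congr rfl fun l _ => ?_
      rw [← hr]; ring
    have h0 := congrArg (fun a => (√N)⁻¹ * a) (hne j)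
    simp only [mul_zero, Finset.mul_sum] at h0
    rw [Pi.add_apply, Pi.add_apply, hS, hB, ← sub_eq_zero, ← neg_eq_zero, ← h0]
    simp only [← Finset.sum_add_distrib, ← Finset.sum_sub_distrib, ← Finset.sum_neg_distrib,
      Finset.mul_sum]
    refine Finset.sum_congr rfl fun i _ => ?_
    simp only [← Finset.mul_sum]
    ring
  rw [smul_sub, Matrix.mulVec_sub, main, Matrix.sub_mulVec, ← Matrix.mulVec_mulVec,
    Matrix.mulVec_smul Q]
  abel

/-! ### Second-order Taylor expansion in the plane -/

lemma taylor_two_remainder {E : Type*} [NormedAddCommGroup E] [NormedSpace ℝ E] {m : E → ℝ}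
    {c : E} (hm : ContDiffAt ℝ 2 m c) {η : ℝ} (hη : 0 < η) :
    ∀ᶠ r in 𝓝 c, |m r - m c - fderiv ℝ m c (r - c) -
      fderiv ℝ (fderiv ℝ m) c (r - c) (r - c) / 2| ≤ η * ‖r - c‖ ^ 2 := by
  set H := fderiv ℝ (fderiv ℝ m) c with hH
  have hsymm : ∀ v w, H v w = H w v := fun v w =>
    (hm.isSymmSndFDerivAt (by simp)) v w
  have hD : ContDiffAt ℝ 1 (fderiv ℝ m) c := hm.fderiv_right (by norm_num)
  have hlo := (hD.differentiableAt one_ne_zero).hasFDerivAt.isLittleO.bound hη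
  have hdiff : ∀ᶠ x in 𝓝 c, DifferentiableAt ℝ m x := by
    have := hm.eventually (by simp)
    filter_upwards [this] with x hx using hx.differentiableAt two_ne_zero
  obtain ⟨ε, hε, hball⟩ := Metric.eventually_nhds_iff_ball.1 (hlo.and hdiff)
  filter_upwards [Metric.ball_mem_nhds c hε] with r hr
  set G : E → ℝ := fun x => m x - m c - fderiv ℝ m c (x - c) - H (x - c) (x - c) / 2 with hG
  have hGd : ∀ x ∈ Metric.closedBall c ‖r - c‖,
      HasFDerivWithinAt G (fderiv ℝ m x - fderiv ℝ m c - H (x - c))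
        (Metric.closedBall c ‖r - c‖) x := by
    intro x hx
    have hxb : x ∈ Metric.ball c ε := by
      refine lt_of_le_of_lt (Metric.mem_closedBall.1 hx) ?_
      rwa [← dist_eq_norm]
    have h1 := (hball x hxb).2.hasFDerivAt
    have h2 : HasFDerivAt (fun x : E => x - c) (ContinuousLinearMap.id ℝ E) x :=
      (hasFDerivAt_id x).sub_const c
    have h3 := (fderiv ℝ m c).hasFDerivAt.comp x h2
    have h4 := (H.hasFDerivAt.comp x h2).clm_apply h2
    have h5 := ((h1.sub_const (m c)).sub h3).sub (h4.mul_const (2⁻¹ : ℝ))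
    have h6 : HasFDerivAt G _ x := h5
    refine (h6.congr_fderiv ?_).hasFDerivWithinAt
    ext v
    simp [hsymm v]
    ring
  have hb : ∀ x ∈ Metric.closedBall c ‖r - c‖,
      ‖fderiv ℝ m x - fderiv ℝ m c - H (x - c)‖ ≤ η * ‖r - c‖ := by
    intro x hx
    have hxb : x ∈ Metric.ball c ε := by
      refine lt_of_le_of_lt (Metric.mem_closedBall.1 hx) ?_
      rwa [← dist_eq_norm]
    refine (hball x hxb).1.trans ?_
    gcongr
    rw [← dist_eq_norm]
    exact hx
  have := (convex_closedBall c ‖r - c‖).norm_image_sub_le_of_norm_hasFDerivWithin_le hGd hb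
    (Metric.mem_closedBall_self (norm_nonneg _)) (y := r) (by simp [dist_eq_norm])
  have hGc : G c = 0 := by simp [hG]
  rw [hGc, sub_zero] at this
  calc _ = ‖G r‖ := rfl
    _ ≤ _ := this.trans_eq (by ring)

lemma plane_eq_sum (v : Plane) : v = v 0 • Pi.single 0 1 + v 1 • Pi.single 1 1 := by
  ext j
  fin_cases j <;> simp

lemma taylor_plane {m : Plane → ℝ} {c : Plane} (hm : ContDiffAt ℝ 2 m c) {η : ℝ} (hη : 0 < η) :
    ∀ᶠ r in 𝓝 c, |m r - (m c + pderiv 0 m c * (r 0 - c 0) + pderiv 1 m c * (r 1 - c 1)) -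
      (pderiv 0 (pderiv 0 m) c / 2 * (r 0 - c 0) ^ 2 +
        pderiv 0 (pderiv 1 m) c * ((r 0 - c 0) * (r 1 - c 1)) +
        pderiv 1 (pderiv 1 m) c / 2 * (r 1 - c 1) ^ 2)| ≤ η * ‖r - c‖ ^ 2 := by
  have hsymm : ∀ v w, fderiv ℝ (fderiv ℝ m) c v w = fderiv ℝ (fderiv ℝ m) c w v := fun v w =>
    (hm.isSymmSndFDerivAt (by simp)) v w
  have hD : DifferentiableAt ℝ (fderiv ℝ m) c :=
    (hm.fderiv_right (m := 1) (by norm_num)).differentiableAt one_ne_zero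
  have h2 : ∀ i j : Fin 2, pderiv i (pderiv j m) c =
      fderiv ℝ (fderiv ℝ m) c (Pi.single i 1) (Pi.single j 1) := by
    intro i j
    have : pderiv j m = fun x => fderiv ℝ m x (Pi.single j 1) := rfl
    rw [pderiv, this, fderiv_clm_apply hD (differentiableAt_const _)]
    simp
  filter_upwards [taylor_two_remainder hm hη] with r hr
  refine le_of_eq_of_le ?_ hr
  congr 1
  rw [plane_eq_sum (r - c), h2, h2, h2]
  simp only [map_add, map_smul, pderiv, add_apply,
    smul_apply, smul_eq_mul, Pi.sub_apply]
  rw [hsymm (Pi.single 1 1) (Pi.single 0 1)]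
  ring

/-! ### Kernel-localized integrals -/

/-- A bounded measurable function on the plane vanishing off a square; products of kernels and
polynomials are of this kind. -/
structure KernelLike (φ : Plane → ℝ) : Prop where
  measurable : Measurable φ
  bounded : ∃ b : ℝ, 0 ≤ b ∧ ∀ z, |φ z| ≤ b
  support : ∃ C : ℝ, 0 < C ∧ ∀ z, φ z ≠ 0 → ∀ j, |z j| ≤ C

lemma isCompact_box (C : ℝ) : IsCompact {z : Plane | ∀ j, |z j| ≤ C} := by
  have : {z : Plane | ∀ j, |z j| ≤ C} = Set.pi Set.univ fun _ => Set.Icc (-C) C := by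
    ext z; simp only [Set.mem_ofPred_eq, Set.mem_univ_pi, Set.mem_Icc, abs_le]
  rw [this]
  exact isCompact_univ_pi fun _ => isCompact_Icc

namespace KernelLike

variable {φ : Plane → ℝ}

lemma integrable (hφ : KernelLike φ) : Integrable φ := by
  obtain ⟨b, _, hb⟩ := hφ.bounded
  obtain ⟨C, _, hC⟩ := hφ.support
  have h : IntegrableOn φ {z : Plane | ∀ j, |z j| ≤ C} :=
    Measure.integrableOn_of_bounded (M := b) (isCompact_box C).measure_lt_top.ne
      hφ.measurable.aestronglyMeasurable (ae_of_all _ hb)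
  refine (integrableOn_iff_integrable_of_support_subset fun z hz => ?_).1 h
  exact hC z hz

lemma integrable_comp {α : Type*} [MeasurableSpace α] {μ : Measure α} [IsFiniteMeasure μ]
    (hφ : KernelLike φ) {g : α → Plane} (hg : Measurable g) : Integrable (fun a => φ (g a)) μ := by
  obtain ⟨b, _, hb⟩ := hφ.bounded
  exact Integrable.of_bound (hφ.measurable.comp hg).aestronglyMeasurable b
    (ae_of_all _ fun a => hb _)

lemma mul_continuous (hφ : KernelLike φ) {g : Plane → ℝ} (hg : Continuous g) :
    KernelLike (fun z => φ z * g z) := by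
  obtain ⟨b, hb0, hb⟩ := hφ.bounded
  obtain ⟨C, hC0, hC⟩ := hφ.support
  obtain ⟨B, hB⟩ := (isCompact_box C).exists_bound_of_continuousOn hg.continuousOn
  refine ⟨hφ.measurable.mul hg.measurable, ⟨b * |B|, by positivity, fun z => ?_⟩,
    ⟨C, hC0, fun z hz => hC z (left_ne_zero_of_mul hz)⟩⟩
  by_cases h : φ z = 0
  · rw [h, zero_mul, abs_zero]; positivity
  · rw [abs_mul]
    exact mul_le_mul (hb z) ((hB z (hC z h)).trans (le_abs_self B)) (abs_nonneg _) hb0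

lemma sq (hφ : KernelLike φ) : KernelLike (fun z => φ z ^ 2) := by
  obtain ⟨b, hb0, hb⟩ := hφ.bounded
  obtain ⟨C, hC0, hC⟩ := hφ.support
  refine ⟨hφ.measurable.pow_const 2, ⟨b ^ 2, by positivity, fun z => ?_⟩,
    ⟨C, hC0, fun z hz => hC z fun h => hz (by simp [h])⟩⟩
  rw [abs_pow]
  exact pow_le_pow_left₀ (abs_nonneg _) (hb z) 2

lemma abs_rpow (hφ : KernelLike φ) {p : ℝ} (hp : 0 < p) : KernelLike (fun z => |φ z| ^ p) := by
  obtain ⟨b, hb0, hb⟩ := hφ.bounded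
  obtain ⟨C, hC0, hC⟩ := hφ.support
  refine ⟨(hφ.measurable.abs).pow_const p, ⟨b ^ p, by positivity, fun z => ?_⟩,
    ⟨C, hC0, fun z hz => hC z fun h => hz (by simp [h, hp.ne'])⟩⟩
  rw [abs_of_nonneg (by positivity)]
  exact Real.rpow_le_rpow (abs_nonneg _) (hb z) hp.le

end KernelLike

lemma KernelRegular.kernelLike {K : Plane → ℝ} (hK : KernelRegular K) : KernelLike K := by
  obtain ⟨b, hb⟩ := hK.bounded
  obtain ⟨C, hC0, hC⟩ := hK.support
  refine ⟨hK.measurable, ⟨b, (hK.nonneg 0).trans (hb 0), fun z => ?_⟩, ⟨C, hC0, fun z hz => ?_⟩⟩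
  · rw [abs_of_nonneg (hK.nonneg z)]; exact hb z
  · by_contra! hcon
    exact hz (hC z hcon)

lemma KernelLike.of_eq_or_zero {φ ψ : Plane → ℝ} (hφ : KernelLike φ) (hψ : Measurable ψ)
    (h : ∀ z, ψ z = φ z ∨ ψ z = 0) : KernelLike ψ := by
  obtain ⟨b, hb0, hb⟩ := hφ.bounded
  obtain ⟨C, hC0, hC⟩ := hφ.support
  refine ⟨hψ, ⟨b, hb0, fun z => ?_⟩, ⟨C, hC0, fun z hz => ?_⟩⟩
  · rcases h z with h | h <;> rw [h]
    · exact hb z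
    · simpa using hb0
  · rcases h z with h | h
    · exact hC z (h ▸ hz)
    · exact absurd h hz

lemma KernelLike.kerPos {K : Plane → ℝ} (hK : KernelLike K) : KernelLike (kerPos K) := by
  refine hK.of_eq_or_zero ?_ fun z => ?_
  · exact Measurable.ite (measurableSet_le measurable_const (measurable_pi_apply 1))
      hK.measurable measurable_const
  · unfold RD.kerPos; split_ifs <;> simp

lemma KernelLike.kerNeg {K : Plane → ℝ} (hK : KernelLike K) : KernelLike (kerNeg K) := by
  refine hK.of_eq_or_zero ?_ fun z => ?_
  · exact Measurable.ite (measurableSet_lt (measurable_pi_apply 1) measurable_const)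
      hK.measurable measurable_const
  · unfold RD.kerNeg; split_ifs <;> simp

lemma continuous_lin (j : Fin 3) : Continuous fun z => lin z j := by
  fin_cases j <;> simp [lin] <;> fun_prop

lemma continuous_quad (j : Fin 3) : Continuous fun z => quad z j := by
  fin_cases j <;> simp [quad] <;> fun_prop

/-- The point `((r₁ - c₁)/h₁, (r₂ - c₂)/h₂)`. -/
noncomputable def rescale (c h r : Plane) : Plane := fun j => (r j - c j) / h j

lemma measurable_rescale (c h : Plane) : Measurable (rescale c h) := by
  unfold rescale; fun_prop

lemma rescale_affine {c h : Plane} (hh : ∀ j, 0 < h j) (z : Plane) :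
    rescale c h (c + h * z) = z := by
  ext j
  simp [rescale, (hh j).ne']

lemma affine_rescale {c h : Plane} (hh : ∀ j, 0 < h j) (r : Plane) :
    c + h * rescale c h r = r := by
  ext j
  simp only [rescale, Pi.add_apply, Pi.mul_apply]
  rw [mul_div_cancel₀ _ (hh j).ne']
  ring

lemma eventually_affine_mem {h : ℕ → Plane} (hh : ∀ j, Tendsto (fun n => h n j) atTop (𝓝 0))
    {c : Plane} {W : Set Plane} (hW : W ∈ 𝓝 c) (C : ℝ) :
    ∀ᶠ n in atTop, ∀ z : Plane, (∀ j, |z j| ≤ C) → c + h n * z ∈ W := by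
  obtain ⟨ε, hε, hb⟩ := Metric.mem_nhds_iff.1 hW
  have h1 : ∀ j, ∀ᶠ n in atTop, |h n j| * |C| < ε := fun j => by
    have := ((hh j).abs).mul_const |C|
    rw [abs_zero, zero_mul] at this
    exact this.eventually_lt_const hε
  filter_upwards [eventually_all.2 h1] with n hn z hz
  refine hb ?_
  rw [Metric.mem_ball, dist_eq_norm, add_sub_cancel_left, pi_norm_lt_iff hε]
  intro j
  rw [Pi.mul_apply, norm_mul]
  refine lt_of_le_of_lt ?_ (hn j)
  exact mul_le_mul_of_nonneg_left ((hz j).trans (le_abs_self C)) (abs_nonneg _)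

/-- For small bandwidths only observations near `c` receive a nonzero kernel weight. -/
lemma KernelLike.eventually_mem {φ : Plane → ℝ} (hφ : KernelLike φ) {h : ℕ → Plane}
    (hh : BandwidthRates h) {c : Plane} {W : Set Plane} (hW : W ∈ 𝓝 c) :
    ∀ᶠ n in atTop, ∀ r, φ (rescale c (h n) r) ≠ 0 → r ∈ W := by
  obtain ⟨C, _, hC⟩ := hφ.support
  filter_upwards [eventually_affine_mem hh.tendsto_zero hW C] with n hn r hr
  rw [← affine_rescale (hh.pos n) (c := c) r]
  exact hn _ (hC _ hr)

lemma integral_comp_rescale {c h : Plane} (hh : ∀ j, 0 < h j) {φ G : Plane → ℝ}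
    (hφ : Measurable φ) (hG : Measurable G) :
    ∫ r, φ (rescale c h r) * G r = h 0 * h 1 * ∫ z, φ z * G (c + h * z) := by
  have hdet : (Matrix.diagonal h).det = h 0 * h 1 := by
    rw [Matrix.det_diagonal, Fin.prod_univ_two]
  have hpos : 0 < h 0 * h 1 := mul_pos (hh 0) (hh 1)
  have hmap := Real.smul_map_diagonal_volume_pi (D := h) (by rw [hdet]; exact hpos.ne')
  have hmeas : Measurable fun r => φ (rescale c h r) * G r :=
    (hφ.comp (measurable_rescale c h)).mul hG
  have hL : Measurable (Matrix.toLin' (Matrix.diagonal h)) :=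
    (LinearMap.continuous_on_pi _).measurable
  have hLe : ∀ z, Matrix.toLin' (Matrix.diagonal h) z = h * z := fun z => by
    ext j; simp [Matrix.mulVec_diagonal]
  calc ∫ r, φ (rescale c h r) * G r = ∫ r, φ (rescale c h (c + r)) * G (c + r) :=
        (integral_add_left_eq_self (fun r => φ (rescale c h r) * G r) c).symm
    _ = h 0 * h 1 * ∫ z, φ (rescale c h (c + h * z)) * G (c + h * z) := by
        conv_lhs => rw [← hmap]
        have hm' : Measurable fun r => φ (rescale c h (c + r)) * G (c + r) :=
          hmeas.comp (measurable_const_add c)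
        rw [integral_smul_measure, integral_map hL.aemeasurable hm'.aestronglyMeasurable]
        simp_rw [hLe]
        rw [hdet, abs_of_pos hpos, ENNReal.toReal_ofReal hpos.le, smul_eq_mul]
    _ = _ := by simp_rw [rescale_affine hh]

section Localization

variable {ρ : Measure Plane} {f : Plane → ℝ} {U : Set Plane} {c : Plane} {h : ℕ → Plane}

lemma DensityRegular.integral_eq (hf : DensityRegular ρ f U c) (g : Plane → ℝ) :
    ∫ r, g r ∂ρ = ∫ r, g r * f r := by
  rw [hf.law, integral_withDensity_eq_integral_toReal_smul hf.measurable.ennreal_ofReal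
    (ae_of_all _ fun _ => ENNReal.ofReal_lt_top)]
  refine integral_congr_ae (ae_of_all _ fun r => ?_)
  simp only [ENNReal.toReal_ofReal (hf.nonneg r), smul_eq_mul]
  ring

/-- Kernel-localized integrals against a continuous density see only its value at `c`. -/
lemma tendsto_localized_integral (hU : IsOpen U) (hcU : c ∈ U) (hf : DensityRegular ρ f U c)
    (hh : BandwidthRates h) {φ : Plane → ℝ} (hφ : KernelLike φ) :
    Tendsto (fun n => (∫ r, φ (rescale c (h n) r) ∂ρ) / (h n 0 * h n 1)) atTop
      (𝓝 (f c * ∫ z, φ z)) := by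
  have hfc : ContinuousAt f c := hf.continuousOn.continuousAt (hU.mem_nhds hcU)
  obtain ⟨C, _, hC⟩ := hφ.support
  have key : ∀ n, (∫ r, φ (rescale c (h n) r) ∂ρ) / (h n 0 * h n 1) =
      ∫ z, φ z * f (c + h n * z) := fun n => by
    rw [hf.integral_eq, integral_comp_rescale (hh.pos n) hφ.measurable hf.measurable,
      mul_div_cancel_left₀ _ (mul_pos (hh.pos n 0) (hh.pos n 1)).ne']
  simp_rw [key]
  rw [← integral_const_mul]
  refine tendsto_integral_filter_of_dominated_convergence (fun z => ‖φ z‖ * (f c + 1))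
    (Eventually.of_forall fun n => ?_) ?_ (hφ.integrable.norm.mul_const _) (ae_of_all _ fun z => ?_)
  · exact (hφ.measurable.mul (hf.measurable.comp (by fun_prop))).aestronglyMeasurable
  · have hW : {r | f r < f c + 1} ∈ 𝓝 c := hfc.eventually_lt_const (by linarith)
    filter_upwards [eventually_affine_mem hh.tendsto_zero hW C] with n hn
    refine ae_of_all _ fun z => ?_
    by_cases hz : φ z = 0
    · simp [hz]
    · rw [norm_mul, Real.norm_of_nonneg (hf.nonneg _)]
      exact mul_le_mul_of_nonneg_left (le_of_lt (hn z (hC z hz))) (norm_nonneg _)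
  · rw [mul_comm (f c)]
    refine Tendsto.const_mul _ (hfc.tendsto.comp ?_)
    have : Tendsto (fun n => h n * z) atTop (𝓝 0) := by
      refine tendsto_pi_nhds.2 fun j => ?_
      have := (hh.tendsto_zero j).mul_const (z j)
      simpa using this
    simpa using this.const_add c

end Localization

/-! ### The effective sample size -/

/-- The effective sample size `n h₁ h₂`. -/
def effSize (h : ℕ → Plane) (n : ℕ) : ℝ := (n : ℝ) * h n 0 * h n 1

lemma effSize_pos {h : ℕ → Plane} (hh : BandwidthRates h) {n : ℕ} (hn : 0 < n) :
    0 < effSize h n := by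
  have := hh.pos n 0
  have := hh.pos n 1
  have : (0 : ℝ) < n := by exact_mod_cast hn
  unfold effSize
  positivity

lemma tendsto_effSize {h : ℕ → Plane} (hh : BandwidthRates h) :
    Tendsto (effSize h) atTop atTop := by
  refine tendsto_atTop_mono' _ ?_ (hh.rate_lower 0)
  have h1 : ∀ᶠ n in atTop, h n 0 < 1 := (hh.tendsto_zero 0).eventually_lt_const one_pos
  filter_upwards [h1, eventually_gt_atTop 0] with n hn hn0
  have h2 := hh.pos n 0
  have h3 : h n 0 ^ 2 ≤ 1 := pow_le_one₀ h2.le hn.le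
  exact mul_le_of_le_one_right (effSize_pos hh hn0).le h3

/-- The second-order Taylor terms are at most of the order of the standard error: `√(n h₁ h₂)` times
a product of two bandwidths stays bounded. -/
lemma sqrt_effSize_mul_bounded {h : ℕ → Plane} (hh : BandwidthRates h) :
    ∃ B : ℝ, 0 ≤ B ∧ ∀ᶠ n in atTop, ∀ j k, √(effSize h n) * (h n j * h n k) ≤ B := by
  have hb : ∀ j k, j ≤ k → ∃ B : ℝ, 0 ≤ B ∧
      ∀ᶠ n in atTop, √(effSize h n) * (h n j * h n k) ≤ B := by
    intro j k hjk
    obtain ⟨a, ha, hlim⟩ := hh.rate_upper j k hjk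
    refine ⟨√(a + 1), Real.sqrt_nonneg _, ?_⟩
    filter_upwards [hlim.eventually_le_const (lt_add_one a), eventually_gt_atTop 0] with n hn hn0
    have h1 : 0 < h n j * h n k := mul_pos (hh.pos n j) (hh.pos n k)
    rw [← Real.sqrt_sq h1.le, ← Real.sqrt_mul (effSize_pos hh hn0).le]
    refine Real.sqrt_le_sqrt (le_trans (le_of_eq ?_) hn)
    simp only [effSize]
    ring
  obtain ⟨B1, hB1, h1⟩ := hb 0 0 le_rfl
  obtain ⟨B2, hB2, h2⟩ := hb 0 1 (by simp)
  obtain ⟨B3, hB3, h3⟩ := hb 1 1 le_rfl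
  refine ⟨B1 + B2 + B3, by positivity, ?_⟩
  filter_upwards [h1, h2, h3] with n h1 h2 h3 j k
  fin_cases j <;> fin_cases k
  · change √(effSize h n) * (h n 0 * h n 0) ≤ _; linarith
  · change √(effSize h n) * (h n 0 * h n 1) ≤ _; linarith
  · change √(effSize h n) * (h n 1 * h n 0) ≤ _; rw [mul_comm (h n 1)]; linarith
  · change √(effSize h n) * (h n 1 * h n 1) ≤ _; linarith

/-! ### Kernel averages -/

/-- The normalized kernel average `(n h₁ h₂)⁻¹ ∑_{i<n} φ((Rᵢ - c)/h)`. -/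
noncomputable def kernelAvg {Ω : Type*} (R : ℕ → Ω → Plane) (c : Plane) (h : ℕ → Plane)
    (φ : Plane → ℝ) (n : ℕ) (ω : Ω) : ℝ :=
  (∑ i ∈ Finset.range n, φ (rescale c (h n) (R i ω))) / effSize h n

/-- Kernel averages converge in probability to `f(c) ∫ φ`. -/
lemma isSmallOp_kernelAvg_sub {Ω : Type*} [MeasurableSpace Ω] {P : Measure Ω}
    [IsProbabilityMeasure P] {R : ℕ → Ω → Plane} (hR : ∀ i, Measurable (R i))
    (hind : iIndepFun R P) {ρ : Measure Plane} [IsProbabilityMeasure ρ]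
    (hlaw : ∀ i, P.map (R i) = ρ) {f : Plane → ℝ} {U : Set Plane} {c : Plane} (hU : IsOpen U)
    (hcU : c ∈ U) (hf : DensityRegular ρ f U c) {h : ℕ → Plane} (hh : BandwidthRates h)
    {φ : Plane → ℝ} (hφ : KernelLike φ) :
    IsSmallOp P (fun n ω => kernelAvg R c h φ n ω - f c * ∫ z, φ z) := by
  set a := f c * ∫ z, φ z with ha
  have hm : ∀ n, Measurable fun r => φ (rescale c (h n) r) / effSize h n := fun n =>
    (hφ.measurable.comp (measurable_rescale c _)).div_const _
  have hlim : Tendsto (fun n => ((∫ r, φ (rescale c (h n) r) ^ 2 ∂ρ) / (h n 0 * h n 1)) *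
      (effSize h n)⁻¹ + ((∫ r, φ (rescale c (h n) r) ∂ρ) / (h n 0 * h n 1) - a) ^ 2)
      atTop (𝓝 0) := by
    have h1 := (tendsto_localized_integral hU hcU hf hh hφ.sq).mul
      (tendsto_inv_atTop_zero.comp (tendsto_effSize hh))
    have h2 := ((tendsto_localized_integral hU hcU hf hh hφ).sub_const a).pow 2
    have := h1.add h2
    simpa [← ha] using this
  refine isSmallOp_of_sq (fun n => ?_) hlim ?_
  · refine Measurable.sub_const (Measurable.div_const (Finset.measurable_sum _ fun i _ => ?_) _) _
    exact hφ.measurable.comp ((measurable_rescale c _).comp (hR i))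
  · filter_upwards [eventually_gt_atTop 0] with n hn
    have hn' : (n : ℝ) ≠ 0 := by exact_mod_cast hn.ne'
    have hN := (effSize_pos hh hn).ne'
    have h0 := (hh.pos n 0).ne'
    have h1 := (hh.pos n 1).ne'
    have hL2 : MemLp (fun r => φ (rescale c (h n) r) / effSize h n) 2 ρ := by
      obtain ⟨b, _, hb⟩ := hφ.bounded
      refine MemLp.of_bound (hm n).aestronglyMeasurable (b / |effSize h n|)
        (ae_of_all _ fun r => ?_)
      rw [Real.norm_eq_abs, abs_div]
      exact div_le_div_of_nonneg_right (hb _) (abs_nonneg _)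
    have key := lintegral_sq_sum_sub_le hR hind hlaw (hm n) hL2 n a
    simp only [kernelAvg, Finset.sum_div]
    refine key.trans (le_of_eq ?_)
    congr 2
    · simp_rw [div_pow]
      rw [integral_div]
      simp only [effSize] at hN ⊢
      field_simp
    · rw [integral_div]
      congr 2
      simp only [effSize] at hN ⊢
      field_simp

/-! ### Conditional moments of the regression errors near the cutoff -/

/-- The part of the regression model on one side that matters for kernel weights concentrating
at `c`, with a globally measurable regression function and a moment exponent `2 + δ ≤ 3`. -/
structure LocalModel (ρ : Measure Plane) (κ : Kernel Plane ℝ) (A : Set Plane) (c : Plane)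
    (m v : Plane → ℝ) : Prop where
  measurable : Measurable m
  moments : ∃ W ∈ 𝓝 c, ∃ δ M : ℝ, 0 < δ ∧ δ ≤ 1 ∧ 0 ≤ M ∧ ∀ᵐ z ∂ρ, z ∈ A ∩ W →
    ∫ y, (y - m z) ∂(κ z) = 0 ∧ ∫ y, (y - m z) ^ 2 ∂(κ z) = v z ∧
    Integrable (fun y => |y - m z| ^ (2 + δ)) (κ z) ∧ ∫ y, |y - m z| ^ (2 + δ) ∂(κ z) ≤ M
  variance_cont : ContinuousWithinAt v A c

lemma rpow_le_one_add_rpow {x p q : ℝ} (hx : 0 ≤ x) (hp : 0 ≤ p) (hpq : p ≤ q) :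
    x ^ p ≤ 1 + x ^ q := by
  rcases le_total x 1 with h | h
  · have := Real.rpow_le_one hx h hp
    have : 0 ≤ x ^ q := by positivity
    linarith
  · have := Real.rpow_le_rpow_of_exponent_le h hpq
    linarith

lemma min_sq_cube_le_rpow {δ : ℝ} (h0 : 0 < δ) (h1 : δ ≤ 1) (x : ℝ) :
    min (x ^ 2) (|x| ^ 3) ≤ |x| ^ (2 + δ) := by
  rcases le_total |x| 1 with h | h
  · refine (min_le_right _ _).trans ?_
    rw [← Real.rpow_natCast |x| 3]
    rcases eq_or_lt_of_le (abs_nonneg x) with hx | hx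
    · rw [← hx, Real.zero_rpow (by norm_num), Real.zero_rpow (by linarith)]
    · exact Real.rpow_le_rpow_of_exponent_ge hx h (by norm_num; linarith)
  · refine (min_le_left _ _).trans ?_
    rw [← sq_abs, ← Real.rpow_natCast |x| 2]
    exact Real.rpow_le_rpow_of_exponent_le h (by norm_num; linarith)

lemma SideRegular.localModel {ρ : Measure Plane} {κ : Kernel Plane ℝ} [IsMarkovKernel κ]
    {A U : Set Plane} {c : Plane} {m v : Plane → ℝ} (hU : IsOpen U) (hcU : c ∈ U)
    (hs : SideRegular ρ κ A U c m v) : LocalModel ρ κ A c (U.indicator m) v where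
  measurable := by
    classical
    rw [← Set.piecewise_eq_indicator]
    exact hs.smooth.continuousOn.measurable_piecewise continuousOn_const hU.measurableSet
  variance_cont := hs.variance_cont
  moments := by
    obtain ⟨δ, hδ, C, hC⟩ := hs.moment
    refine ⟨U, hU.mem_nhds hcU, min δ 1, 1 + max C 0, by positivity, min_le_right _ _,
      by positivity, ?_⟩
    filter_upwards [hs.mean, hs.variance, hC] with z h1 h2 h3 hz
    rw [Set.indicator_of_mem hz.2]
    have h3 := h3 hz
    have hm : Measurable fun y : ℝ => |y - m z| ^ (2 + δ) := by fun_prop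
    have hi : Integrable (fun y : ℝ => |y - m z| ^ (2 + δ)) (κ z) := by
      refine (lintegral_ofReal_ne_top_iff_integrable hm.aestronglyMeasurable
        (ae_of_all _ fun y => by positivity)).1 (ne_top_of_le_ne_top ENNReal.ofReal_ne_top h3)
    have hle : ∀ y : ℝ, |y - m z| ^ (2 + min δ 1) ≤ 1 + |y - m z| ^ (2 + δ) := fun y =>
      rpow_le_one_add_rpow (abs_nonneg _) (by positivity) (by gcongr; exact min_le_left _ _)
    have hi1 : Integrable (fun y : ℝ => 1 + |y - m z| ^ (2 + δ)) (κ z) :=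
      (integrable_const _).add hi
    have hi' : Integrable (fun y : ℝ => |y - m z| ^ (2 + min δ 1)) (κ z) := by
      have hm' : Measurable fun y : ℝ => |y - m z| ^ (2 + min δ 1) := by
        exact (measurable_id.sub_const _).abs.pow_const _
      refine hi1.mono' hm'.aestronglyMeasurable (ae_of_all _ fun y => ?_)
      rw [Real.norm_of_nonneg (by positivity)]
      exact hle y
    refine ⟨(h1 hz.1).2, h2 hz, hi', (integral_mono hi' hi1 hle).trans ?_⟩
    rw [integral_add (integrable_const _) hi]
    have : ∫ y, |y - m z| ^ (2 + δ) ∂(κ z) ≤ max C 0 := by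
      rw [integral_eq_lintegral_of_nonneg_ae (ae_of_all _ fun y => by positivity)
        hm.aestronglyMeasurable]
      refine (ENNReal.toReal_mono ENNReal.ofReal_ne_top h3).trans ?_
      rw [ENNReal.toReal_ofReal']
    simpa using this

lemma integrable_compProd_of_bound {α β : Type*} [MeasurableSpace α] [MeasurableSpace β]
    {ρ : Measure α} [IsFiniteMeasure ρ] {κ : Kernel α β} [IsMarkovKernel κ] {F : α × β → ℝ}
    (hF : Measurable F) (h0 : ∀ p, 0 ≤ F p) {B : ℝ}
    (h : ∀ᵐ x ∂ρ, Integrable (fun y => F (x, y)) (κ x) ∧ ∫ y, F (x, y) ∂(κ x) ≤ B) :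
    Integrable F (ρ ⊗ₘ κ) := by
  refine (Measure.integrable_compProd_iff hF.aestronglyMeasurable).2
    ⟨h.mono fun x hx => hx.1, ?_⟩
  simp_rw [Real.norm_of_nonneg (h0 _)]
  refine Integrable.of_bound
    (hF.stronglyMeasurable.integral_kernel_prod_right').aestronglyMeasurable B ?_
  filter_upwards [h] with x hx
  rw [Real.norm_of_nonneg (integral_nonneg fun y => h0 _)]
  exact hx.2

/-- The kernel-weighted regression error `(n h₁ h₂)^{-1/2} a((r - c)/h) (y - m(r))` of one
observation `(r, y)`. -/
noncomputable def score (a m : Plane → ℝ) (c : Plane) (h : ℕ → Plane) (n : ℕ) (p : Plane × ℝ) : ℝ :=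
  (√(effSize h n))⁻¹ * a (rescale c (h n) p.1) * (p.2 - m p.1)

section Score

variable {ρ : Measure Plane} [IsProbabilityMeasure ρ] {κ : Kernel Plane ℝ} [IsMarkovKernel κ]
  {A U : Set Plane} {c : Plane} {a f m v : Plane → ℝ} {h : ℕ → Plane}

lemma measurable_score (ha : Measurable a) (hm : Measurable m) (n : ℕ) :
    Measurable (score a m c h n) := by
  unfold score
  have : Measurable fun p : Plane × ℝ => rescale c (h n) p.1 :=
    (measurable_rescale c (h n)).comp measurable_fst
  exact (measurable_const.mul (ha.comp this)).mul (measurable_snd.sub (hm.comp measurable_fst))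

lemma memLp_score (hh : BandwidthRates h) (hmod : LocalModel ρ κ A c m v) (ha : KernelLike a)
    (hA : ∀ᶠ n in atTop, ∀ᵐ r ∂ρ, a (rescale c (h n) r) ≠ 0 → r ∈ A) :
    ∀ᶠ n in atTop, MemLp (score a m c h n) 2 (ρ ⊗ₘ κ) := by
  obtain ⟨W, hW, δ, M, hδ, -, hM, hmom⟩ := hmod.moments
  obtain ⟨b, hb0, hb⟩ := ha.bounded
  filter_upwards [hA, ha.eventually_mem hh hW] with n hA hWn
  have hmeas := measurable_score (c := c) (h := h) ha.measurable hmod.measurable n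
  refine (memLp_two_iff_integrable_sq hmeas.aestronglyMeasurable).2
    (integrable_compProd_of_bound (B := ((√(effSize h n))⁻¹ * b) ^ 2 * (1 + M))
      (hmeas.pow_const 2) (fun p => sq_nonneg _) ?_)
  filter_upwards [hA, hmom] with r hr hmom
  by_cases h0 : a (rescale c (h n) r) = 0
  · simp only [score, h0]
    simp
    positivity
  · obtain ⟨-, -, h3, h4⟩ := hmom ⟨hr h0, hWn r h0⟩
    have hle : ∀ y : ℝ, (y - m r) ^ 2 ≤ 1 + |y - m r| ^ (2 + δ) := fun y => by
      rw [← sq_abs, ← Real.rpow_natCast]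
      exact rpow_le_one_add_rpow (abs_nonneg _) (by norm_num) (by norm_num; linarith)
    have hi1 : Integrable (fun y : ℝ => 1 + |y - m r| ^ (2 + δ)) (κ r) :=
      (integrable_const _).add h3
    have hi2 : Integrable (fun y : ℝ => (y - m r) ^ 2) (κ r) := by
      refine hi1.mono' (by fun_prop) (ae_of_all _ fun y => ?_)
      rw [Real.norm_of_nonneg (by positivity)]
      exact hle y
    have hb2 : ∫ y, (y - m r) ^ 2 ∂(κ r) ≤ 1 + M := by
      refine (integral_mono hi2 hi1 hle).trans ?_
      rw [integral_add (integrable_const _) h3]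
      simpa using h4
    simp only [score, mul_pow _ (_ - m r)]
    refine ⟨hi2.const_mul _, ?_⟩
    rw [integral_const_mul]
    refine mul_le_mul ?_ hb2 (integral_nonneg fun y => sq_nonneg _) (sq_nonneg _)
    refine sq_le_sq' ?_ ?_
    · have := neg_le_of_abs_le (hb (rescale c (h n) r))
      rw [← mul_neg]
      gcongr
    · have := le_of_abs_le (hb (rescale c (h n) r))
      gcongr

lemma integral_score_eq_zero (hh : BandwidthRates h) (hmod : LocalModel ρ κ A c m v)
    (ha : KernelLike a) (hA : ∀ᶠ n in atTop, ∀ᵐ r ∂ρ, a (rescale c (h n) r) ≠ 0 → r ∈ A) :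
    ∀ᶠ n in atTop, ∫ p, score a m c h n p ∂(ρ ⊗ₘ κ) = 0 := by
  obtain ⟨W, hW, δ, M, hδ, -, hM, hmom⟩ := hmod.moments
  filter_upwards [hA, ha.eventually_mem hh hW, memLp_score hh hmod ha hA] with n hA hWn hL
  rw [Measure.integral_compProd (hL.integrable (by norm_num))]
  refine integral_eq_zero_of_ae ?_
  filter_upwards [hA, hmom] with r hr hmom
  simp only [score, Pi.zero_apply]
  rw [integral_const_mul]
  by_cases h0 : a (rescale c (h n) r) = 0
  · simp [h0]
  · rw [(hmom ⟨hr h0, hWn r h0⟩).1, mul_zero]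

lemma tendsto_score_variance (hU : IsOpen U) (hcU : c ∈ U) (hf : DensityRegular ρ f U c)
    (hh : BandwidthRates h) (hmod : LocalModel ρ κ A c m v) (ha : KernelLike a)
    (hA : ∀ᶠ n in atTop, ∀ᵐ r ∂ρ, a (rescale c (h n) r) ≠ 0 → r ∈ A) :
    Tendsto (fun n : ℕ => (n : ℝ) * ∫ p, score a m c h n p ^ 2 ∂(ρ ⊗ₘ κ)) atTop
      (𝓝 (f c * v c * ∫ z, a z ^ 2)) := by
  obtain ⟨W, hW, δ, M, hδ, -, hM, hmom⟩ := hmod.moments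
  set J : ℕ → ℝ := fun n => (∫ r, a (rescale c (h n) r) ^ 2 ∂ρ) / (h n 0 * h n 1) with hJ
  have hJlim : Tendsto J atTop (𝓝 (f c * ∫ z, a z ^ 2)) :=
    tendsto_localized_integral hU hcU hf hh ha.sq
  -- `v` need not be measurable, so it is compared pointwise with its limit inside the integral
  suffices hd : Tendsto (fun n : ℕ => (n : ℝ) * ∫ p, score a m c h n p ^ 2 ∂(ρ ⊗ₘ κ) - v c * J n)
      atTop (𝓝 0) by
    have := hd.add (hJlim.const_mul (v c))
    simp only [sub_add_cancel] at this
    convert this using 2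
    ring
  have hL0 : 0 ≤ f c * ∫ z, a z ^ 2 :=
    mul_nonneg (hf.nonneg c) (integral_nonneg fun z => sq_nonneg _)
  set L := f c * ∫ z, a z ^ 2 with hL
  rw [Metric.tendsto_atTop']
  intro ε hε
  set η := ε / (2 * (L + 1)) with hη
  have hη0 : 0 < η := by positivity
  obtain ⟨W', hW', hvW⟩ : ∃ W' ∈ 𝓝 c, ∀ r ∈ A ∩ W', |v r - v c| ≤ η := by
    have : ∀ᶠ r in 𝓝[A] c, |v r - v c| ≤ η := by
      have := hmod.variance_cont.tendsto.sub_const (v c)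
      rw [sub_self] at this
      filter_upwards [this.abs.eventually_le_const (by simpa using hη0)] with r hr using hr
    obtain ⟨W', hW', hs⟩ := mem_nhdsWithin_iff_exists_mem_nhds_inter.1 this
    exact ⟨W', hW', fun r hr => hs ⟨hr.2, hr.1⟩⟩
  obtain ⟨n₀, hn₀⟩ := eventually_atTop.1 (hA.and ((ha.eventually_mem hh hW).and
    ((ha.eventually_mem hh hW').and ((memLp_score hh hmod ha hA).and
      ((hJlim.eventually_le_const (lt_add_one L)).and (eventually_gt_atTop 0))))))
  refine ⟨n₀, fun n hn => ?_⟩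
  obtain ⟨hA, hWn, hWn', hLp, hJn, hn0⟩ := hn₀ n hn.le
  have hN := effSize_pos hh hn0
  have hn0' : (0 : ℝ) < n := by exact_mod_cast hn0
  have h0 := hh.pos n 0
  have h1 := hh.pos n 1
  have hint : Integrable (fun p => score a m c h n p ^ 2) (ρ ⊗ₘ κ) := hLp.integrable_sq
  have hin : ∀ r, ∫ y, score a m c h n (r, y) ^ 2 ∂(κ r) = (effSize h n)⁻¹ *
      (a (rescale c (h n) r) ^ 2 * ∫ y, (y - m r) ^ 2 ∂(κ r)) := fun r => by
    simp only [score, mul_pow _ (_ - m r)]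
    rw [integral_const_mul, mul_pow, inv_pow, Real.sq_sqrt hN.le]
    ring
  have hval : (n : ℝ) * ∫ p, score a m c h n p ^ 2 ∂(ρ ⊗ₘ κ) =
      (∫ r, a (rescale c (h n) r) ^ 2 * ∫ y, (y - m r) ^ 2 ∂(κ r) ∂ρ) / (h n 0 * h n 1) := by
    rw [Measure.integral_compProd hint]
    simp_rw [hin]
    rw [integral_const_mul]
    simp only [effSize]
    field_simp
  have hi1 : Integrable (fun r => a (rescale c (h n) r) ^ 2 * ∫ y, (y - m r) ^ 2 ∂(κ r)) ρ := by
    have := ((Measure.integrable_compProd_iff hint.aestronglyMeasurable).1 hint).2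
    simp_rw [Real.norm_of_nonneg (sq_nonneg _), hin] at this
    refine (this.const_mul (effSize h n)).congr (ae_of_all _ fun r => ?_)
    simp only
    rw [mul_inv_cancel_left₀ hN.ne']
  have hi2 : Integrable (fun r => a (rescale c (h n) r) ^ 2) ρ :=
    ha.sq.integrable_comp (measurable_rescale c (h n))
  have hbound : |(∫ r, a (rescale c (h n) r) ^ 2 * ∫ y, (y - m r) ^ 2 ∂(κ r) ∂ρ) -
      v c * ∫ r, a (rescale c (h n) r) ^ 2 ∂ρ| ≤ η * ∫ r, a (rescale c (h n) r) ^ 2 ∂ρ := by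
    rw [← integral_const_mul, ← integral_const_mul, ← integral_sub hi1 (hi2.const_mul _)]
    rw [← Real.norm_eq_abs]
    refine norm_integral_le_of_norm_le (hi2.const_mul _) ?_
    filter_upwards [hA, hmom] with r hr hmom
    by_cases hz : a (rescale c (h n) r) = 0
    · simp [hz]
    · rw [(hmom ⟨hr hz, hWn r hz⟩).2.1, mul_comm (v c), ← mul_sub, norm_mul, mul_comm,
        Real.norm_of_nonneg (sq_nonneg _)]
      exact mul_le_mul_of_nonneg_right (hvW r ⟨hr hz, hWn' r hz⟩) (sq_nonneg _)
  rw [Real.dist_0_eq_abs, hval, hJ]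
  simp only
  rw [← mul_div_assoc, ← sub_div, abs_div, abs_of_pos (mul_pos h0 h1)]
  have hJ' : (∫ r, a (rescale c (h n) r) ^ 2 ∂ρ) / (h n 0 * h n 1) ≤ L + 1 := hJn
  calc _ ≤ η * (∫ r, a (rescale c (h n) r) ^ 2 ∂ρ) / (h n 0 * h n 1) := by gcongr
    _ = η * ((∫ r, a (rescale c (h n) r) ^ 2 ∂ρ) / (h n 0 * h n 1)) := by ring
    _ ≤ η * (L + 1) := by gcongr
    _ = ε / 2 := by rw [hη]; field_simp
    _ < ε := by linarith

/-- The negligibility condition of the triangular-array central limit theorem, from the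
conditional moments of order `2 + δ`. -/
lemma tendsto_score_truncated (hU : IsOpen U) (hcU : c ∈ U) (hf : DensityRegular ρ f U c)
    (hh : BandwidthRates h) (hmod : LocalModel ρ κ A c m v) (ha : KernelLike a)
    (hA : ∀ᶠ n in atTop, ∀ᵐ r ∂ρ, a (rescale c (h n) r) ≠ 0 → r ∈ A) :
    Tendsto (fun n : ℕ => (n : ℝ) *
      ∫ p, min (score a m c h n p ^ 2) (|score a m c h n p| ^ 3) ∂(ρ ⊗ₘ κ)) atTop (𝓝 0) := by
  obtain ⟨W, hW, δ, M, hδ, hδ1, hM, hmom⟩ := hmod.moments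
  have hlim : Tendsto (fun n => √(effSize h n) ^ (-δ) *
      (M * ((∫ r, |a (rescale c (h n) r)| ^ (2 + δ) ∂ρ) / (h n 0 * h n 1)))) atTop (𝓝 0) := by
    have h1 := (tendsto_rpow_neg_atTop hδ).comp
      (Real.tendsto_sqrt_atTop.comp (tendsto_effSize hh))
    have h2 := (tendsto_localized_integral hU hcU hf hh
      (ha.abs_rpow (p := 2 + δ) (by linarith))).const_mul M
    simpa using h1.mul h2
  refine squeeze_zero' (Eventually.of_forall fun n => ?_) ?_ hlim
  · exact mul_nonneg (Nat.cast_nonneg n) (integral_nonneg fun p => by positivity)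
  filter_upwards [hA, ha.eventually_mem hh hW, memLp_score hh hmod ha hA,
    eventually_gt_atTop 0] with n hA hWn hLp hn0
  have hN := effSize_pos hh hn0
  have hn0' : (0 : ℝ) < n := by exact_mod_cast hn0
  have h0 := hh.pos n 0
  have h1 := hh.pos n 1
  have hs : 0 < √(effSize h n) := Real.sqrt_pos.2 hN
  have hmeas := measurable_score (c := c) (h := h) ha.measurable hmod.measurable n
  have hint : Integrable (fun p => min (score a m c h n p ^ 2) (|score a m c h n p| ^ 3))
      (ρ ⊗ₘ κ) := by
    refine hLp.integrable_sq.mono' (by fun_prop) (ae_of_all _ fun p => ?_)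
    rw [Real.norm_of_nonneg (by positivity)]
    exact min_le_left _ _
  have hi : Integrable (fun r => (√(effSize h n))⁻¹ ^ (2 + δ) * M *
      |a (rescale c (h n) r)| ^ (2 + δ)) ρ :=
    ((ha.abs_rpow (p := 2 + δ) (by linarith)).integrable_comp
      (measurable_rescale c (h n))).const_mul _
  have hle : ∫ p, min (score a m c h n p ^ 2) (|score a m c h n p| ^ 3) ∂(ρ ⊗ₘ κ) ≤
      (√(effSize h n))⁻¹ ^ (2 + δ) * M * ∫ r, |a (rescale c (h n) r)| ^ (2 + δ) ∂ρ := by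
    rw [Measure.integral_compProd hint, ← integral_const_mul]
    refine integral_mono_of_nonneg (ae_of_all _ fun r => integral_nonneg fun y => by positivity)
      hi ?_
    filter_upwards [hA, hmom] with r hr hmom
    by_cases hz : a (rescale c (h n) r) = 0
    · have : (0 : ℝ) ^ (2 + δ) = 0 := Real.zero_rpow (by linarith)
      simp [score, hz, this]
    · obtain ⟨-, -, h3, h4⟩ := hmom ⟨hr hz, hWn r hz⟩
      have hpt : ∀ y, min (score a m c h n (r, y) ^ 2) (|score a m c h n (r, y)| ^ 3) ≤
          ((√(effSize h n))⁻¹ ^ (2 + δ) * |a (rescale c (h n) r)| ^ (2 + δ)) *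
            |y - m r| ^ (2 + δ) := fun y => by
        refine (min_sq_cube_le_rpow hδ hδ1 _).trans (le_of_eq ?_)
        simp only [score, abs_mul]
        rw [abs_of_pos (inv_pos.2 hs), Real.mul_rpow (by positivity) (abs_nonneg _),
          Real.mul_rpow (by positivity) (abs_nonneg _)]
      refine (integral_mono_of_nonneg (ae_of_all _ fun y => by positivity) (h3.const_mul _)
        (ae_of_all _ hpt)).trans ?_
      rw [integral_const_mul]
      calc _ ≤ ((√(effSize h n))⁻¹ ^ (2 + δ) * |a (rescale c (h n) r)| ^ (2 + δ)) * M := by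
            gcongr
        _ = _ := by ring
  refine (mul_le_mul_of_nonneg_left hle hn0'.le).trans (le_of_eq ?_)
  have hpow : (√(effSize h n))⁻¹ ^ (2 + δ) = (effSize h n)⁻¹ * √(effSize h n) ^ (-δ) := by
    rw [Real.rpow_add (inv_pos.2 hs), Real.rpow_neg hs.le, ← Real.inv_rpow hs.le]
    congr 1
    rw [← Nat.cast_ofNat, Real.rpow_natCast, inv_pow, Real.sq_sqrt hN.le]
  rw [hpow]
  generalize √(effSize h n) ^ (-δ) = s
  simp only [effSize]
  field_simp

end Score

/-! ### Linearization of the one-sided estimator -/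

lemma IsSmallOp.of_forall_le_mul {Ω : Type*} [MeasurableSpace Ω] {P : Measure Ω}
    {X Y : ℕ → Ω → ℝ} (hX : IsBigOp P X)
    (h : ∀ η : ℝ, 0 < η → ∀ᶠ n in atTop, ∀ᵐ ω ∂P, |Y n ω| ≤ η * |X n ω|) : IsSmallOp P Y := by
  intro ε hε
  rw [ENNReal.tendsto_nhds_zero]
  intro e he
  obtain ⟨M, hM, h1⟩ := hX e he
  filter_upwards [h1, h (ε / M) (by positivity)] with n h1 h2
  refine (measure_mono_ae ?_).trans h1
  filter_upwards [h2] with ω h2 h3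
  have h3 : ε < |Y n ω| := h3
  change M < |X n ω|
  by_contra! hcon
  have : ε / M * |X n ω| ≤ ε / M * M := by gcongr
  rw [div_mul_cancel₀ _ hM.ne'] at this
  linarith

lemma KernelLike.abs {φ : Plane → ℝ} (hφ : KernelLike φ) : KernelLike (fun z => |φ z|) := by
  simpa using hφ.abs_rpow one_pos

/-- The local-linear coefficients `(m(c), ∂₁m(c), ∂₂m(c))` of `m` at `c`. -/
noncomputable def taylorCoef (m : Plane → ℝ) (c : Plane) : Fin 3 → ℝ :=
  ![m c, pderiv 0 m c, pderiv 1 m c]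

/-- The error of the coefficients of the local-linear fit, multiplied by `(1, h₁, h₂)`. -/
noncomputable def coefError (m : Plane → ℝ) (c h : Plane) (β : Fin 3 → ℝ) : Fin 3 → ℝ :=
  fun l => lin h l * (β l - taylorCoef m c l)

/-- The remainder of the second-order Taylor expansion of `m` at `c`, the quadratic part being
written in the rescaled variable. -/
noncomputable def taylorRem (m : Plane → ℝ) (c h r : Plane) : ℝ :=
  m r - ∑ l, taylorCoef m c l * lin (r - c) l - ∑ l, quad (rescale c h r) l * biasVec m c h l

lemma sub_eq_mul_rescale {c h : Plane} (hh : ∀ j, 0 < h j) (r : Plane) (j : Fin 2) :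
    r j - c j = h j * rescale c h r j := by
  rw [rescale, mul_div_cancel₀ _ (hh j).ne']

lemma lin_sub_eq {c h : Plane} (hh : ∀ j, 0 < h j) (r : Plane) (l : Fin 3) :
    lin (r - c) l = lin h l * lin (rescale c h r) l := by
  have h0 := sub_eq_mul_rescale (c := c) hh r 0
  have h1 := sub_eq_mul_rescale (c := c) hh r 1
  fin_cases l
  · simp [lin]
  · simpa [lin] using h0
  · simpa [lin] using h1

lemma lin_pos {h : Plane} (hh : ∀ j, 0 < h j) (l : Fin 3) : 0 < lin h l := by
  fin_cases l
  · simp [lin]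
  · simpa [lin] using hh 0
  · simpa [lin] using hh 1

lemma norm_sq_le (v : Plane) : ‖v‖ ^ 2 ≤ v 0 ^ 2 + v 1 ^ 2 := by
  have : ‖v‖ ≤ √(v 0 ^ 2 + v 1 ^ 2) := by
    refine (pi_norm_le_iff_of_nonneg (Real.sqrt_nonneg _)).2 fun j => ?_
    refine Real.le_sqrt_of_sq_le ?_
    rw [Real.norm_eq_abs, sq_abs]
    fin_cases j
    · simpa using sq_nonneg (v 1)
    · simpa using sq_nonneg (v 0)
  calc ‖v‖ ^ 2 ≤ √(v 0 ^ 2 + v 1 ^ 2) ^ 2 := by gcongr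
    _ = _ := Real.sq_sqrt (by positivity)

lemma taylorRem_small {m : Plane → ℝ} {c : Plane} {h : ℕ → Plane} (hh : BandwidthRates h)
    (hm : ContDiffAt ℝ 2 m c) {φ : Plane → ℝ} (hφ : KernelLike φ) {η : ℝ} (hη : 0 < η) :
    ∀ᶠ n in atTop, ∀ r, φ (rescale c (h n) r) ≠ 0 →
      √(effSize h n) * |taylorRem m c (h n) r| ≤ η := by
  obtain ⟨C, hC0, hC⟩ := hφ.support
  obtain ⟨B, hB0, hB⟩ := sqrt_effSize_mul_bounded hh
  have hη' : 0 < η / (2 * (B + 1) * C ^ 2) := by positivity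
  filter_upwards [hφ.eventually_mem hh (taylor_plane hm hη'), hB] with n hn hBn r hr
  have hrem : taylorRem m c (h n) r =
      m r - (m c + pderiv 0 m c * (r 0 - c 0) + pderiv 1 m c * (r 1 - c 1)) -
      (pderiv 0 (pderiv 0 m) c / 2 * (r 0 - c 0) ^ 2 +
        pderiv 0 (pderiv 1 m) c * ((r 0 - c 0) * (r 1 - c 1)) +
        pderiv 1 (pderiv 1 m) c / 2 * (r 1 - c 1) ^ 2) := by
    have h0 := sub_eq_mul_rescale (c := c) (hh.pos n) r 0
    have h1 := sub_eq_mul_rescale (c := c) (hh.pos n) r 1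
    simp [taylorRem, taylorCoef, lin, quad, biasVec, Fin.sum_univ_three, h0, h1]
    ring
  have hbd := hn r hr
  rw [← hrem] at hbd
  have hsq : ‖r - c‖ ^ 2 ≤ C ^ 2 * (h n 0 * h n 0 + h n 1 * h n 1) := by
    refine (norm_sq_le _).trans ?_
    have hj : ∀ j, (r - c) j ^ 2 ≤ C ^ 2 * (h n j * h n j) := fun j => by
      rw [Pi.sub_apply, sub_eq_mul_rescale (hh.pos n), mul_pow, mul_comm, ← sq (h n j)]
      have := sq_le_sq' (neg_le_of_abs_le (hC _ hr j)) (le_of_abs_le (hC _ hr j))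
      gcongr
    linarith [hj 0, hj 1]
  calc √(effSize h n) * |taylorRem m c (h n) r|
      ≤ √(effSize h n) * (η / (2 * (B + 1) * C ^ 2) *
          (C ^ 2 * (h n 0 * h n 0 + h n 1 * h n 1))) := by
        gcongr
        exact hbd.trans (by gcongr)
    _ = η / (2 * (B + 1)) * (√(effSize h n) * (h n 0 * h n 0) +
          √(effSize h n) * (h n 1 * h n 1)) := by field_simp
    _ ≤ η / (2 * (B + 1)) * (B + B) := by
        gcongr
        · exact hBn 0 0
        · exact hBn 1 1
    _ ≤ η / (2 * (B + 1)) * (2 * (B + 1)) := by gcongr; linarith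
    _ = η := by field_simp

lemma sqrt_effSize_biasVec_bounded {h : ℕ → Plane} (hh : BandwidthRates h) (m : Plane → ℝ)
    (c : Plane) : ∃ B : ℝ, ∀ᶠ n in atTop, |‖√(effSize h n) • biasVec m c (h n)‖| ≤ B := by
  obtain ⟨B, hB0, hB⟩ := sqrt_effSize_mul_bounded hh
  set d : Fin 3 → ℝ := ![pderiv 0 (pderiv 0 m) c / 2, pderiv 0 (pderiv 1 m) c,
    pderiv 1 (pderiv 1 m) c / 2] with hd
  refine ⟨‖d‖ * B, ?_⟩
  filter_upwards [hB] with n hn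
  rw [abs_norm]
  have key : ∀ (l : Fin 3) (j k : Fin 2), biasVec m c (h n) l = d l * (h n j * h n k) →
      ‖(√(effSize h n) • biasVec m c (h n)) l‖ ≤ ‖d‖ * B := by
    intro l j k e
    have h0 := hh.pos n j
    have h1 := hh.pos n k
    rw [Pi.smul_apply, smul_eq_mul, e, mul_left_comm, norm_mul, Real.norm_of_nonneg
      (r := √(effSize h n) * _) (by positivity)]
    exact mul_le_mul (norm_le_pi_norm d l) (hn j k) (by positivity) (norm_nonneg _)
  refine (pi_norm_le_iff_of_nonneg (by positivity)).2 fun l => ?_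
  fin_cases l
  · exact key 0 0 0 (by simp [biasVec, hd, sq])
  · exact key 1 0 1 (by simp [biasVec, hd])
  · exact key 2 1 1 (by simp [biasVec, hd, sq])

section Side

variable {Ω : Type*} [MeasurableSpace Ω] {P : Measure Ω} [IsProbabilityMeasure P]
  {R : ℕ → Ω → Plane} {Y : ℕ → Ω → ℝ} {ρ : Measure Plane} [IsProbabilityMeasure ρ]
  {κ : Kernel Plane ℝ} [IsMarkovKernel κ] {A U : Set Plane} {c : Plane}
  {K k f m v : Plane → ℝ} {h : ℕ → Plane}

lemma isBigOp_kernelAvg (hR : ∀ i, Measurable (R i))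
    (hind : iIndepFun R P) (hlaw : ∀ i, P.map (R i) = ρ) (hU : IsOpen U)
    (hcU : c ∈ U) (hf : DensityRegular ρ f U c) (hh : BandwidthRates h)
    {φ : Plane → ℝ} (hφ : KernelLike φ) : IsBigOp P (kernelAvg R c h φ) := by
  have h1 := (isSmallOp_kernelAvg_sub hR hind hlaw hU hcU hf hh hφ).isBigOp
  have h2 : IsBigOp P (fun _ _ => f c * ∫ z, φ z) := isBigOp_of_bounded
    (b := fun _ => f c * ∫ z, φ z) ⟨_, Eventually.of_forall fun _ => le_rfl⟩
  simpa using h1.add h2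

/-- The score sums are bounded in probability. -/
lemma isBigOp_sum_score (hRY : ∀ i, Measurable fun ω => (R i ω, Y i ω))
    (hind : iIndepFun (fun i ω => (R i ω, Y i ω)) P)
    (hlaw : ∀ i, P.map (fun ω => (R i ω, Y i ω)) = ρ ⊗ₘ κ) (hU : IsOpen U) (hcU : c ∈ U)
    (hf : DensityRegular ρ f U c) (hh : BandwidthRates h) (hmod : LocalModel ρ κ A c m v)
    {a : Plane → ℝ} (ha : KernelLike a)
    (hA : ∀ᶠ n in atTop, ∀ᵐ r ∂ρ, a (rescale c (h n) r) ≠ 0 → r ∈ A) :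
    IsBigOp P (fun n ω => ∑ i ∈ Finset.range n, score a m c h n (R i ω, Y i ω)) := by
  have hmeas := fun n => measurable_score (c := c) (h := h) ha.measurable hmod.measurable n
  refine isBigOp_of_sq (b := f c * v c * (∫ z, a z ^ 2) + 1)
    (fun n => Finset.measurable_sum _ fun i _ => (hmeas n).comp (hRY i)) ?_
  filter_upwards [memLp_score hh hmod ha hA, integral_score_eq_zero hh hmod ha hA,
    (tendsto_score_variance hU hcU hf hh hmod ha hA).eventually_le_const (lt_add_one _)]
    with n hL h0 hv
  have := lintegral_sq_sum_sub_le hRY hind hlaw (hmeas n) hL n 0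
  simp only [sub_zero, h0, mul_zero] at this
  refine this.trans (ENNReal.ofReal_le_ofReal ?_)
  simpa using hv

open Classical in
/-- The local-linear estimator is determined by the linear system of its normal equations. -/
lemma normal_equations_rescaled {n : ℕ} (hn : 0 < n) (hh : BandwidthRates h) {r : ℕ → Plane}
    {y : ℕ → ℝ} {β : Fin 3 → ℝ}
    (hmin : ∀ b, criterion K A c (h n) n r y β ≤ criterion K A c (h n) n r y b)
    (hside : ∀ i, K (rescale c (h n) (r i)) * (if r i ∈ A then 1 else 0) =
      k (rescale c (h n) (r i))) (Q : Matrix (Fin 3) (Fin 3) ℝ) :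
    (Matrix.of fun j l => (∑ i ∈ Finset.range n, k (rescale c (h n) (r i)) *
        (lin (rescale c (h n) (r i)) j * lin (rescale c (h n) (r i)) l)) / effSize h n).mulVec
        (√(effSize h n) • (coefError m c (h n) β - Q.mulVec (biasVec m c (h n)))) =
      (fun j => ∑ i ∈ Finset.range n, score (fun z => k z * lin z j) m c h n (r i, y i)) +
      (fun j => ∑ i ∈ Finset.range n, (√(effSize h n))⁻¹ * (k (rescale c (h n) (r i)) *
        lin (rescale c (h n) (r i)) j) * taylorRem m c (h n) (r i)) +
      ((Matrix.of fun j l => (∑ i ∈ Finset.range n, k (rescale c (h n) (r i)) *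
        (lin (rescale c (h n) (r i)) j * quad (rescale c (h n) (r i)) l)) / effSize h n) -
        (Matrix.of fun j l => (∑ i ∈ Finset.range n, k (rescale c (h n) (r i)) *
        (lin (rescale c (h n) (r i)) j * lin (rescale c (h n) (r i)) l)) / effSize h n) *
          Q).mulVec (√(effSize h n) • biasVec m c (h n)) := by
  have hpos := hh.pos n
  refine rescaled_normal_equations (Finset.range n) (fun i => k (rescale c (h n) (r i)))
    (fun i => y i - m (r i)) (fun i => taylorRem m c (h n) (r i))
    (fun i => lin (rescale c (h n) (r i))) (fun i => quad (rescale c (h n) (r i)))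
    (coefError m c (h n) β) (biasVec m c (h n)) Q (effSize_pos hh hn) fun j => ?_
  have hcrit : ∀ b, criterion K A c (h n) n r y b = ∑ i ∈ Finset.range n,
      k (rescale c (h n) (r i)) * (y i - ∑ l, b l * lin (r i - c) l) ^ 2 := fun b => by
    refine Finset.sum_congr rfl fun i _ => ?_
    rw [← hside i, Fin.sum_univ_three]
    simp only [lin, Matrix.cons_val_zero, Matrix.cons_val_one, Matrix.cons_val, Pi.sub_apply]
    rw [show (fun j => (r i j - c j) / h n j) = rescale c (h n) (r i) from rfl]
    ring
  simp_rw [hcrit] at hmin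
  have hne := normal_equations (Finset.range n) (fun i => k (rescale c (h n) (r i))) y
    (fun i => lin (r i - c)) β hmin j
  have hs := lin_pos hpos j
  have e : ∀ i, k (rescale c (h n) (r i)) * lin (r i - c) j *
      (y i - ∑ l, β l * lin (r i - c) l) = lin (h n) j * (k (rescale c (h n) (r i)) *
        lin (rescale c (h n) (r i)) j * (y i - m (r i) + taylorRem m c (h n) (r i) +
          ∑ l, quad (rescale c (h n) (r i)) l * biasVec m c (h n) l -
          ∑ l, coefError m c (h n) β l * lin (rescale c (h n) (r i)) l)) := by
    intro i
    have h1 : ∑ l, coefError m c (h n) β l * lin (rescale c (h n) (r i)) l =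
        ∑ l, β l * lin (r i - c) l - ∑ l, taylorCoef m c l * lin (r i - c) l := by
      rw [← Finset.sum_sub_distrib]
      refine Finset.sum_congr rfl fun l _ => ?_
      rw [lin_sub_eq hpos, coefError]
      ring
    rw [h1, taylorRem]
    rw [show lin (r i - c) j = lin (h n) j * lin (rescale c (h n) (r i)) j from
      lin_sub_eq hpos _ _]
    ring
  simp_rw [e] at hne
  rw [← Finset.mul_sum] at hne
  exact (mul_eq_zero.1 hne).resolve_left hs.ne'

open Classical in
/-- **Asymptotic linearity** of the one-sided local-linear estimator: up to `o_p(1)`, the rescaled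
and bias-corrected coefficient error is `(f(c) S)⁻¹` times the vector of score sums. -/
theorem isSmallOp_coefError_sub (hRY : IIDSample P R Y) (hlawR : P.map (R 0) = ρ)
    (hlaw : P.map (fun ω => (R 0 ω, Y 0 ω)) = ρ ⊗ₘ κ) (hU : IsOpen U) (hcU : c ∈ U)
    (hf : DensityRegular ρ f U c) (hh : BandwidthRates h) (hmod : LocalModel ρ κ A c m v)
    (hm : ContDiffAt ℝ 2 m c) (hk : KernelLike k) (hS : IsUnit (momS k).det)
    (hside : ∀ᶠ n in atTop, ∀ᵐ r ∂ρ, K (rescale c (h n) r) * (if r ∈ A then 1 else 0) =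
      k (rescale c (h n) r)) {β : ℕ → Ω → Fin 3 → ℝ} (hβ : IsLocalLinear P R Y K A c h β) :
    IsSmallOp P (fun n ω => ‖√(effSize h n) • (coefError m c (h n) (β n ω) -
        ((momS k)⁻¹ * momB k).mulVec (biasVec m c (h n))) -
      (f c • momS k)⁻¹.mulVec (fun j => ∑ i ∈ Finset.range n,
        score (fun z => k z * lin z j) m c h n (R i ω, Y i ω))‖) := by
  have hR := hRY.measurable_R
  have hpair : ∀ i, Measurable fun ω => (R i ω, Y i ω) := fun i =>
    (hR i).prodMk (hRY.measurable_Y i)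
  have hlaws : ∀ i, P.map (fun ω => (R i ω, Y i ω)) = ρ ⊗ₘ κ := fun i =>
    (hRY.ident i).map_eq.trans hlaw
  have hlawRs : ∀ i, P.map (R i) = ρ := fun i => by
    rw [← hlawR]
    exact ((hRY.ident i).comp measurable_fst).map_eq
  have hindR : iIndepFun R P := hRY.indep.comp (fun _ => Prod.fst) (fun _ => measurable_fst)
  have hA : ∀ g : Plane → ℝ, ∀ᶠ n in atTop, ∀ᵐ r ∂ρ,
      k (rescale c (h n) r) * g (rescale c (h n) r) ≠ 0 → r ∈ A := fun g => by
    filter_upwards [hside] with n hn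
    filter_upwards [hn] with r hr h0
    by_contra hcon
    rw [if_neg hcon, mul_zero] at hr
    exact h0 (by rw [← hr, zero_mul])
  have hklin : ∀ j, KernelLike (fun z => k z * lin z j) := fun j =>
    hk.mul_continuous (continuous_lin j)
  set Q := (momS k)⁻¹ * momB k with hQ
  set F := f c • momS k with hF
  have hFu : IsUnit F.det := by
    rw [hF, Matrix.det_smul]
    exact ((isUnit_iff_ne_zero.2 hf.pos.ne').pow _).mul hS
  have hFQ : F * Q = f c • momB k := by
    rw [hF, hQ, smul_mul_assoc, Matrix.mul_nonsing_inv_cancel_left _ _ hS]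
  set W : ℕ → Ω → Fin 3 → ℝ := fun n ω j => ∑ i ∈ Finset.range n,
    score (fun z => k z * lin z j) m c h n (R i ω, Y i ω) with hW
  set Sn : ℕ → Ω → Matrix (Fin 3) (Fin 3) ℝ := fun n ω => Matrix.of fun j l =>
    kernelAvg R c h (fun z => k z * (lin z j * lin z l)) n ω with hSn
  set Bn : ℕ → Ω → Matrix (Fin 3) (Fin 3) ℝ := fun n ω => Matrix.of fun j l =>
    kernelAvg R c h (fun z => k z * (lin z j * quad z l)) n ω with hBn
  set rem : ℕ → Ω → Fin 3 → ℝ := fun n ω j => ∑ i ∈ Finset.range n,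
    (√(effSize h n))⁻¹ * (k (rescale c (h n) (R i ω)) * lin (rescale c (h n) (R i ω)) j) *
      taylorRem m c (h n) (R i ω) with hrem
  set u : ℕ → Fin 3 → ℝ := fun n => √(effSize h n) • biasVec m c (h n) with hu
  have hlinlin : ∀ j l, KernelLike (fun z => k z * (lin z j * lin z l)) := fun j l =>
    hk.mul_continuous ((continuous_lin j).mul (continuous_lin l))
  have hlinquad : ∀ j l, KernelLike (fun z => k z * (lin z j * quad z l)) := fun j l =>
    hk.mul_continuous ((continuous_lin j).mul (continuous_quad l))
  -- the Gram matrices converge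
  have hSsmall : IsSmallOp P (fun n ω => entrySum (F - Sn n ω)) := by
    refine IsSmallOp.sum _ fun j _ => IsSmallOp.sum _ fun l _ => ?_
    refine (isSmallOp_kernelAvg_sub hR hindR hlawRs hU hcU hf hh (hlinlin j l)).mono
      (Eventually.of_forall fun n => ae_of_all _ fun ω => le_of_eq ?_)
    rw [abs_abs, abs_sub_comm]
    simp [hF, hSn, momS]
  have hBsmall : IsSmallOp P (fun n ω => entrySum (Bn n ω - f c • momB k)) := by
    refine IsSmallOp.sum _ fun j _ => IsSmallOp.sum _ fun l _ => ?_
    refine (isSmallOp_kernelAvg_sub hR hindR hlawRs hU hcU hf hh (hlinquad j l)).mono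
      (Eventually.of_forall fun n => ae_of_all _ fun ω => le_of_eq ?_)
    rw [abs_abs]
    simp [hBn, momB]
  have hubig : IsBigOp P (fun n (_ : Ω) => ‖u n‖) :=
    isBigOp_of_bounded (sqrt_effSize_biasVec_bounded hh m c)
  -- the Taylor remainder is negligible
  have hremsmall : ∀ j, IsSmallOp P (fun n ω => rem n ω j) := fun j => by
    refine IsSmallOp.of_forall_le_mul
      (isBigOp_kernelAvg hR hindR hlawRs hU hcU hf hh (hklin j).abs) fun η hη => ?_
    filter_upwards [taylorRem_small hh hm (hklin j) hη, eventually_gt_atTop 0] with n hn hn0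
    refine ae_of_all _ fun ω => ?_
    have hN := effSize_pos hh hn0
    have hs : 0 < √(effSize h n) := Real.sqrt_pos.2 hN
    have hnn : 0 ≤ kernelAvg R c h (fun z => |k z * lin z j|) n ω :=
      div_nonneg (Finset.sum_nonneg fun _ _ => abs_nonneg _) hN.le
    rw [abs_of_nonneg hnn, kernelAvg, ← mul_div_assoc, Finset.mul_sum, Finset.sum_div]
    refine (Finset.abs_sum_le_sum_abs _ _).trans (Finset.sum_le_sum fun i _ => ?_)
    by_cases h0 : k (rescale c (h n) (R i ω)) * lin (rescale c (h n) (R i ω)) j = 0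
    · simp [h0]
    · have := hn _ h0
      have hinv : (√(effSize h n))⁻¹ = √(effSize h n) / effSize h n := by
        rw [eq_div_iff hN.ne', ← div_eq_inv_mul, div_eq_iff hs.ne', Real.mul_self_sqrt hN.le]
      rw [hinv, abs_mul, abs_mul, abs_of_pos (div_pos hs hN)]
      calc _ = (√(effSize h n) * |taylorRem m c (h n) (R i ω)|) *
            |k (rescale c (h n) (R i ω)) * lin (rescale c (h n) (R i ω)) j| / effSize h n := by
            ring
        _ ≤ _ := by gcongr
  have hnorm : ∀ v : Fin 3 → ℝ, ‖v‖ ≤ ∑ j, |v j| := fun v =>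
    (pi_norm_le_iff_of_nonneg (Finset.sum_nonneg fun j _ => abs_nonneg (v j))).2 fun j =>
      Finset.single_le_sum (f := fun j => |v j|) (fun j _ => abs_nonneg (v j)) (Finset.mem_univ j)
  have hWbig : IsBigOp P (fun n ω => ‖F⁻¹.mulVec (W n ω)‖) := by
    have h1 : IsBigOp P (fun n ω => ∑ j, ∑ l, |F⁻¹ j l| * |W n ω l|) := by
      refine IsBigOp.sum _ fun j _ => IsBigOp.sum _ fun l _ => ?_
      have hb := isBigOp_sum_score hpair hRY.indep hlaws hU hcU hf hh hmod (hklin l)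
        (hA fun z => lin z l)
      intro ε hε
      obtain ⟨M, hM, hM'⟩ := hb ε hε
      refine ⟨(|F⁻¹ j l| + 1) * M, by positivity, hM'.mono fun n hn => ?_⟩
      refine (measure_mono fun ω hω => ?_).trans hn
      have hω : (|F⁻¹ j l| + 1) * M < |(|F⁻¹ j l| * |W n ω l|)| := hω
      rw [abs_mul, abs_abs, abs_abs] at hω
      change M < |W n ω l|
      by_contra! hcon
      have : |F⁻¹ j l| * |W n ω l| ≤ (|F⁻¹ j l| + 1) * M := by
        gcongr
        linarith
      linarith
    refine h1.mono (Eventually.of_forall fun n => ae_of_all _ fun ω => ?_)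
    rw [abs_norm]
    refine ((hnorm _).trans (Finset.sum_le_sum fun j _ => ?_)).trans (le_abs_self _)
    rw [Matrix.mulVec, dotProduct]
    refine (Finset.abs_sum_le_sum_abs _ _).trans (Finset.sum_le_sum fun l _ => ?_)
    rw [abs_mul]
  have hconst : ∀ b : ℝ, IsBigOp P (fun _ (_ : Ω) => b) := fun b =>
    isBigOp_of_bounded (b := fun _ => b) ⟨|b|, Eventually.of_forall fun _ => le_rfl⟩
  -- everything on the right of the normal equations apart from the scores
  have hDsmall : IsSmallOp P (fun n ω => (∑ j, |rem n ω j|) +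
      (entrySum (Bn n ω - f c • momB k) * ‖u n‖ +
        entrySum (F - Sn n ω) * (entrySum Q * ‖u n‖))) := by
    refine (IsSmallOp.sum _ fun j _ => (hremsmall j).abs).add
      ((hBsmall.mul_isBigOp hubig).add (hSsmall.mul_isBigOp ?_))
    refine isBigOp_of_bounded (b := fun n => entrySum Q * ‖u n‖) ?_
    obtain ⟨B, hB⟩ := sqrt_effSize_biasVec_bounded hh m c
    refine ⟨|entrySum Q| * B, hB.mono fun n hn => ?_⟩
    rw [abs_mul]
    gcongr
  have hae : ∀ᶠ n in atTop, ∀ᵐ ω ∂P, ∀ i, K (rescale c (h n) (R i ω)) *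
      (if R i ω ∈ A then 1 else 0) = k (rescale c (h n) (R i ω)) := by
    filter_upwards [hside] with n hn
    refine ae_all_iff.2 fun i => ?_
    rw [← hlawRs i] at hn
    exact ae_of_ae_map (hR i).aemeasurable hn
  refine IsSmallOp.of_le_add_mul
    (δ := fun n ω => ((∑ j, |rem n ω j|) +
      (entrySum (Bn n ω - f c • momB k) * ‖u n‖ +
        entrySum (F - Sn n ω) * (entrySum Q * ‖u n‖))) * entrySum F⁻¹)
    (η := fun n ω => entrySum (F - Sn n ω) * entrySum F⁻¹)
    (Y := fun n ω => ‖F⁻¹.mulVec (W n ω)‖)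
    (hDsmall.mul_isBigOp (hconst _)) (hSsmall.mul_isBigOp (hconst _)) hWbig
    (fun _ _ => norm_nonneg _) (fun _ _ => norm_nonneg _) ?_
  filter_upwards [hae, eventually_gt_atTop 0] with n hn hn0
  filter_upwards [hn, hβ.isMin n] with ω hω hmin
  have hsys := normal_equations_rescaled (m := m) (k := k) hn0 hh hmin hω Q
  have hsys' : (Sn n ω).mulVec (√(effSize h n) • (coefError m c (h n) (β n ω) -
      Q.mulVec (biasVec m c (h n)))) =
      W n ω + rem n ω + (Bn n ω - Sn n ω * Q).mulVec (u n) := hsys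
  have hpert := norm_sub_inv_mulVec_le hFu (W := W n ω) hsys'
  have hDW : ‖W n ω + rem n ω + (Bn n ω - Sn n ω * Q).mulVec (u n) - W n ω‖ ≤
      (∑ j, |rem n ω j|) + (entrySum (Bn n ω - f c • momB k) * ‖u n‖ +
        entrySum (F - Sn n ω) * (entrySum Q * ‖u n‖)) := by
    have e : W n ω + rem n ω + (Bn n ω - Sn n ω * Q).mulVec (u n) - W n ω = rem n ω +
        ((Bn n ω - f c • momB k).mulVec (u n) + (F - Sn n ω).mulVec (Q.mulVec (u n))) := by
      rw [Matrix.mulVec_mulVec, ← Matrix.add_mulVec, Matrix.sub_mul, hFQ]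
      rw [sub_add_sub_cancel]
      abel
    rw [e]
    refine (norm_add_le _ _).trans (add_le_add (hnorm _) ((norm_add_le _ _).trans
      (add_le_add (norm_mulVec_le _ _) ((norm_mulVec_le _ _).trans ?_))))
    exact mul_le_mul_of_nonneg_left (norm_mulVec_le _ _) (entrySum_nonneg _)
  refine hpert.trans ?_
  rw [mul_comm (entrySum F⁻¹) ‖_‖, mul_comm (entrySum F⁻¹) (entrySum (F - _))]
  gcongr
  exact entrySum_nonneg _

end Side

/-! ### The two sides of the cutoff -/

section Geometry

variable {ρ : Measure Plane} {f : Plane → ℝ} {U T : Set Plane} {c : Plane} {K : Plane → ℝ}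
  {h : ℕ → Plane}

lemma DensityRegular.ae_ne (hf : DensityRegular ρ f U c) : ∀ᵐ r ∂ρ, r 1 ≠ c 1 := by
  have h0 : ρ ≪ volume := by
    rw [hf.law]
    exact withDensity_absolutelyContinuous _ _
  suffices h1 : ∀ᵐ r : Plane, r 1 ≠ c 1 from h0.ae_le h1
  rw [ae_iff]
  simp only [ne_eq, not_not]
  exact Measure.pi_hyperplane (fun _ : Fin 2 => (volume : Measure ℝ)) 1 (c 1)

lemma setOf_abs_sub_lt_mem_nhds (c : Plane) {δ : ℝ} (hδ : 0 < δ) :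
    {r : Plane | ∀ j, |r j - c j| < δ} ∈ 𝓝 c := by
  refine Filter.mem_of_superset (Metric.ball_mem_nhds c hδ) fun r hr j => ?_
  rw [Metric.mem_ball, dist_eq_norm] at hr
  exact lt_of_le_of_lt (norm_le_pi_norm (r - c) j) hr

open Classical in
lemma treated_weight_ae_eq (hT : LocallyHalfPlane T c) (hf : DensityRegular ρ f U c)
    (hK : KernelLike K) (hh : BandwidthRates h) :
    ∀ᶠ n in atTop, ∀ᵐ r ∂ρ, K (rescale c (h n) r) * (if r ∈ T then 1 else 0) =
      kerPos K (rescale c (h n) r) := by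
  obtain ⟨δ, hδ, hT⟩ := hT
  filter_upwards [hK.eventually_mem hh (setOf_abs_sub_lt_mem_nhds c hδ)] with n hn
  filter_upwards [hf.ae_ne] with r hr
  by_cases h0 : K (rescale c (h n) r) = 0
  · simp [kerPos, h0]
  · have hbox := hT r fun j => (hn r h0 j).le
    have h1 := hh.pos n 1
    rcases lt_or_gt_of_ne hr with hlt | hgt
    · have hz : ¬ 0 ≤ rescale c (h n) r 1 :=
        not_le.2 (div_neg_of_neg_of_pos (sub_neg.2 hlt) h1)
      have : r ∉ T := fun hrT => absurd (hbox.2 hrT) (not_le.2 hlt)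
      simp [kerPos, hz, this]
    · have hz : 0 ≤ rescale c (h n) r 1 := (div_pos (sub_pos.2 hgt) h1).le
      simp [kerPos, hz, hbox.1 hgt]

open Classical in
lemma control_weight_ae_eq (hT : LocallyHalfPlane T c) (hf : DensityRegular ρ f U c)
    (hK : KernelLike K) (hh : BandwidthRates h) :
    ∀ᶠ n in atTop, ∀ᵐ r ∂ρ, K (rescale c (h n) r) * (if r ∈ control T then 1 else 0) =
      kerNeg K (rescale c (h n) r) := by
  obtain ⟨δ, hδ, hT⟩ := hT
  filter_upwards [hK.eventually_mem hh (setOf_abs_sub_lt_mem_nhds c hδ)] with n hn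
  filter_upwards [hf.ae_ne] with r hr
  by_cases h0 : K (rescale c (h n) r) = 0
  · simp [kerNeg, h0]
  · have hbox := hn r h0
    have h1 := hh.pos n 1
    rcases lt_or_gt_of_ne hr with hlt | hgt
    · have hz : rescale c (h n) r 1 < 0 := div_neg_of_neg_of_pos (sub_neg.2 hlt) h1
      have : r ∈ control T := by
        intro hcl
        have ho : IsOpen {s : Plane | (∀ j, |s j - c j| < δ) ∧ s 1 < c 1} := by
          simp only [Set.ofPred_and, Set.ofPred_forall]
          refine IsOpen.inter (isOpen_iInter_of_finite fun j => ?_) ?_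
          · exact isOpen_lt (by fun_prop) continuous_const
          · exact isOpen_lt (by fun_prop) continuous_const
        obtain ⟨s, hs, hsT⟩ := mem_closure_iff.1 hcl _ ho ⟨hbox, hlt⟩
        exact absurd ((hT s fun j => (hs.1 j).le).2 hsT) (not_le.2 hs.2)
      simp [kerNeg, hz, this]
    · have hz : ¬ rescale c (h n) r 1 < 0 := not_lt.2 (div_pos (sub_pos.2 hgt) h1).le
      have : r ∉ control T := fun hcon =>
        hcon (subset_closure ((hT r fun j => (hbox j).le).1 hgt))
      simp [kerNeg, hz, this]

end Geometry

lemma kerPos_mul_kerNeg (K : Plane → ℝ) (z : Plane) : kerPos K z * kerNeg K z = 0 := by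
  unfold kerPos kerNeg
  rcases le_or_gt 0 (z 1) with h | h
  · simp [not_lt.2 h]
  · simp [not_le.2 h]

lemma indicator_eventuallyEq {U : Set Plane} {c : Plane} (hU : IsOpen U) (hcU : c ∈ U)
    (m : Plane → ℝ) : U.indicator m =ᶠ[𝓝 c] m := by
  filter_upwards [hU.mem_nhds hcU] with z hz
  exact Set.indicator_of_mem hz m

lemma biasVec_congr {m m' : Plane → ℝ} {c : Plane} (h : m =ᶠ[𝓝 c] m') (b : Plane) :
    biasVec m c b = biasVec m' c b := by
  have h1 : ∀ j, pderiv j m =ᶠ[𝓝 c] pderiv j m' := fun j => by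
    filter_upwards [h.fderiv (𝕜 := ℝ)] with z hz
    rw [pderiv, hz, pderiv]
  have h2 : ∀ i j, pderiv i (pderiv j m) c = pderiv i (pderiv j m') c := fun i j => by
    rw [pderiv, (h1 j).fderiv_eq, pderiv]
  simp only [biasVec, h2]

/-! ### The asymptotic variance -/

/-- The kernel of the influence function of the intercept: `k(z)` times the first entry of
`(f(c) S)⁻¹ (1, z₁, z₂)'`. -/
noncomputable def interceptKernel (k : Plane → ℝ) (fc : ℝ) (z : Plane) : ℝ :=
  k z * ∑ j, (fc • momS k)⁻¹ 0 j * lin z j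

lemma KernelLike.interceptKernel {k : Plane → ℝ} (hk : KernelLike k) (fc : ℝ) :
    KernelLike (interceptKernel k fc) :=
  hk.mul_continuous (continuous_finsetSum _ fun j _ => continuous_const.mul (continuous_lin j))

lemma inv_mulVec_sum_score (k m : Plane → ℝ) (c : Plane) (h : ℕ → Plane) (fc : ℝ) (n : ℕ)
    (p : ℕ → Plane × ℝ) :
    (fc • momS k)⁻¹.mulVec (fun j => ∑ i ∈ Finset.range n,
      score (fun z => k z * lin z j) m c h n (p i)) 0 =
    ∑ i ∈ Finset.range n, score (interceptKernel k fc) m c h n (p i) := by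
  simp only [Matrix.mulVec, dotProduct, Finset.mul_sum]
  rw [Finset.sum_comm]
  refine Finset.sum_congr rfl fun i _ => ?_
  simp only [score, interceptKernel, Finset.mul_sum, Finset.sum_mul]
  refine Finset.sum_congr rfl fun j _ => ?_
  ring

lemma momS_transpose (k : Plane → ℝ) : (momS k).transpose = momS k := by
  ext i j
  simp only [momS, Matrix.transpose_apply, Matrix.of_apply]
  congr 1
  ext z
  ring

/-- The sandwich form of the variance of the influence function. -/
lemma integral_interceptKernel_sq {k : Plane → ℝ} (hk : KernelLike k)
    (hS : IsUnit (momS k).det) {fc : ℝ} (hfc : 0 < fc) (s : ℝ) :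
    fc * s * ∫ z, interceptKernel k fc z ^ 2 =
      s / fc * ((momS k)⁻¹ * momK k * (momS k)⁻¹) 0 0 := by
  have hinv : (fc • momS k)⁻¹ = fc⁻¹ • (momS k)⁻¹ := by
    refine Matrix.inv_eq_left_inv ?_
    rw [smul_mul_smul_comm, inv_mul_cancel₀ hfc.ne', Matrix.nonsing_inv_mul _ hS, one_smul]
  have hsymm : ∀ l, (momS k)⁻¹ l 0 = (momS k)⁻¹ 0 l := fun l => by
    have : ((momS k)⁻¹).transpose = (momS k)⁻¹ := by
      rw [Matrix.transpose_nonsing_inv, momS_transpose]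
    exact congrFun (congrFun this 0) l
  have hint : ∀ j l, Integrable fun z => k z ^ 2 * (lin z j * lin z l) := fun j l =>
    (hk.sq.mul_continuous ((continuous_lin j).mul (continuous_lin l))).integrable
  have hexp : ∀ z, interceptKernel k fc z ^ 2 = ∑ j, ∑ l,
      (fc⁻¹ ^ 2 * (momS k)⁻¹ 0 j * (momS k)⁻¹ 0 l) * (k z ^ 2 * (lin z j * lin z l)) := by
    intro z
    rw [interceptKernel, hinv, mul_pow, sq (∑ j, _), Finset.sum_mul_sum, Finset.mul_sum]
    refine Finset.sum_congr rfl fun j _ => ?_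
    rw [Finset.mul_sum]
    refine Finset.sum_congr rfl fun l _ => ?_
    simp only [Matrix.smul_apply, smul_eq_mul]
    ring
  simp_rw [hexp]
  rw [integral_finsetSum _ fun j _ => integrable_finsetSum _ fun l _ => (hint j l).const_mul _]
  simp_rw [integral_finsetSum _ fun l _ => (hint _ l).const_mul _, integral_const_mul,
    Matrix.mul_apply, hsymm, Finset.sum_mul]
  rw [Finset.sum_comm, Finset.mul_sum, Finset.mul_sum]
  refine Finset.sum_congr rfl fun l _ => ?_
  rw [Finset.mul_sum, Finset.mul_sum]
  refine Finset.sum_congr rfl fun j _ => ?_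
  simp only [momK, Matrix.of_apply]
  field_simp

end RD

theorem theorem1 {Ω : Type*} [MeasurableSpace Ω] (P : Measure Ω) [IsProbabilityMeasure P]
    (R : ℕ → Ω → RD.Plane) (Y : ℕ → Ω → ℝ) (hRY : RD.IIDSample P R Y)
    (T : Set RD.Plane) (hT : MeasurableSet T) (c : RD.Plane) (hTc : RD.LocallyHalfPlane T c)
    (U : Set RD.Plane) (hU : IsOpen U) (hcU : c ∈ U)
    (f : RD.Plane → ℝ) (hf : RD.DensityRegular (P.map (R 0)) f U c)
    (K : RD.Plane → ℝ) (hK : RD.KernelRegular K)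
    (mPos mNeg vPos vNeg : RD.Plane → ℝ)
    (hPos : RD.SideRegular (P.map (R 0)) (condDistrib (Y 0) (R 0) P) T U c mPos vPos)
    (hNeg : RD.SideRegular (P.map (R 0)) (condDistrib (Y 0) (R 0) P) (RD.control T) U c mNeg vNeg)
    (h : ℕ → RD.Plane) (hh : RD.BandwidthRates h)
    (bPos bNeg : ℕ → Ω → Fin 3 → ℝ)
    (hbPos : RD.IsLocalLinear P R Y K T c h bPos)
    (hbNeg : RD.IsLocalLinear P R Y K (RD.control T) c h bNeg) :
    ∃ V : NNReal, (V : ℝ) = RD.asympVar K f vPos vNeg c ∧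
      TendstoInDistribution
        (fun (n : ℕ) (ω : Ω) =>
          Real.sqrt ((n : ℝ) * h n 0 * h n 1) *
            ((bPos n ω 0 - bNeg n ω 0) - (mPos c - mNeg c) -
              (RD.biasTerm (RD.kerPos K) mPos c (h n) -
                RD.biasTerm (RD.kerNeg K) mNeg c (h n))))
        atTop (id : ℝ → ℝ) (fun _ => P) (gaussianReal 0 V) := by
  classical
  set ρ := P.map (R 0) with hρ
  set κ := condDistrib (Y 0) (R 0) P with hκ
  have hρ1 : IsProbabilityMeasure ρ :=
    Measure.isProbabilityMeasure_map (hRY.measurable_R 0).aemeasurable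
  have hlaw : P.map (fun ω => (R 0 ω, Y 0 ω)) = ρ ⊗ₘ κ :=
    (compProd_map_condDistrib (hRY.measurable_Y 0).aemeasurable).symm
  have hlaws : ∀ i, P.map (fun ω => (R i ω, Y i ω)) = ρ ⊗ₘ κ := fun i =>
    (hRY.ident i).map_eq.trans hlaw
  have hpair : ∀ i, Measurable fun ω => (R i ω, Y i ω) := fun i =>
    (hRY.measurable_R i).prodMk (hRY.measurable_Y i)
  have hKl := hK.kernelLike
  have hsP := RD.treated_weight_ae_eq hTc hf hKl hh
  have hsN := RD.control_weight_ae_eq hTc hf hKl hh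
  -- off `U` the regression functions are arbitrary, so they are replaced by zero there
  have hmodP := hPos.localModel hU hcU
  have hmodN := hNeg.localModel hU hcU
  have hcdP : ContDiffAt ℝ 2 (U.indicator mPos) c :=
    (hPos.smooth.contDiffAt (hU.mem_nhds hcU)).congr_of_eventuallyEq
      (RD.indicator_eventuallyEq hU hcU mPos)
  have hcdN : ContDiffAt ℝ 2 (U.indicator mNeg) c :=
    (hNeg.smooth.contDiffAt (hU.mem_nhds hcU)).congr_of_eventuallyEq
      (RD.indicator_eventuallyEq hU hcU mNeg)
  have haP := hKl.kerPos.interceptKernel (f c)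
  have haN := hKl.kerNeg.interceptKernel (f c)
  have hAP : ∀ᶠ n in atTop, ∀ᵐ r ∂ρ,
      RD.interceptKernel (RD.kerPos K) (f c) (RD.rescale c (h n) r) ≠ 0 → r ∈ T := by
    filter_upwards [hsP] with n hn
    filter_upwards [hn] with r hr h0
    by_contra hcon
    rw [if_neg hcon, mul_zero] at hr
    exact h0 (by rw [RD.interceptKernel, ← hr, zero_mul])
  have hAN : ∀ᶠ n in atTop, ∀ᵐ r ∂ρ,
      RD.interceptKernel (RD.kerNeg K) (f c) (RD.rescale c (h n) r) ≠ 0 → r ∈ RD.control T := by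
    filter_upwards [hsN] with n hn
    filter_upwards [hn] with r hr h0
    by_contra hcon
    rw [if_neg hcon, mul_zero] at hr
    exact h0 (by rw [RD.interceptKernel, ← hr, zero_mul])
  set gP := RD.score (RD.interceptKernel (RD.kerPos K) (f c)) (U.indicator mPos) c h with hgP
  set gN := RD.score (RD.interceptKernel (RD.kerNeg K) (f c)) (U.indicator mNeg) c h with hgN
  have hgPm : ∀ n, Measurable (gP n) := RD.measurable_score haP.measurable hmodP.measurable
  have hgNm : ∀ n, Measurable (gN n) := RD.measurable_score haN.measurable hmodN.measurable
  -- an observation contributes to one side only, so cross terms vanish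
  have hdisj : ∀ n p, gP n p = 0 ∨ gN n p = 0 := by
    intro n p
    rcases mul_eq_zero.1 (RD.kerPos_mul_kerNeg K (RD.rescale c (h n) p.1)) with h0 | h0
    · left; simp [hgP, RD.score, RD.interceptKernel, h0]
    · right; simp [hgN, RD.score, RD.interceptKernel, h0]
  have hLP : ∀ᶠ n in atTop, MemLp (gP n) 2 (ρ ⊗ₘ κ) := RD.memLp_score hh hmodP haP hAP
  have hLN : ∀ᶠ n in atTop, MemLp (gN n) 2 (ρ ⊗ₘ κ) := RD.memLp_score hh hmodN haN hAN
  have hsq : ∀ᶠ n : ℕ in atTop, (n : ℝ) * ∫ p, gP n p ^ 2 ∂(ρ ⊗ₘ κ) +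
      (n : ℝ) * ∫ p, gN n p ^ 2 ∂(ρ ⊗ₘ κ) =
      (n : ℝ) * ∫ p, (gP n p - gN n p) ^ 2 ∂(ρ ⊗ₘ κ) := by
    filter_upwards [hLP, hLN] with n h1 h2
    rw [← mul_add, ← integral_add h1.integrable_sq h2.integrable_sq]
    congr 2
    ext p
    rcases hdisj n p with h0 | h0 <;> rw [h0] <;> ring
  have hV := ((RD.tendsto_score_variance hU hcU hf hh hmodP haP hAP).add
    (RD.tendsto_score_variance hU hcU hf hh hmodN haN hAN)).congr' hsq
  rw [RD.integral_interceptKernel_sq hKl.kerPos hK.nonsing_pos hf.pos,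
    RD.integral_interceptKernel_sq hKl.kerNeg hK.nonsing_neg hf.pos] at hV
  have hVeq : RD.asympVar K f vPos vNeg c =
      vPos c / f c * ((RD.momS (RD.kerPos K))⁻¹ * RD.momK (RD.kerPos K) *
        (RD.momS (RD.kerPos K))⁻¹) 0 0 +
      vNeg c / f c * ((RD.momS (RD.kerNeg K))⁻¹ * RD.momK (RD.kerNeg K) *
        (RD.momS (RD.kerNeg K))⁻¹) 0 0 := by
    simp [RD.asympVar]
  rw [← hVeq] at hV
  have hV0 : 0 ≤ RD.asympVar K f vPos vNeg c :=
    ge_of_tendsto hV (Eventually.of_forall fun n =>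
      mul_nonneg (Nat.cast_nonneg n) (integral_nonneg fun p => sq_nonneg _))
  obtain ⟨V, hVV⟩ : ∃ V : NNReal, (V : ℝ) = RD.asympVar K f vPos vNeg c := ⟨⟨_, hV0⟩, rfl⟩
  refine ⟨V, hVV, ?_⟩
  rw [← hVV] at hV
  have hmin : ∀ᶠ n : ℕ in atTop,
      (n : ℝ) * ∫ p, min (gP n p ^ 2) (|gP n p| ^ 3) ∂(ρ ⊗ₘ κ) +
      (n : ℝ) * ∫ p, min (gN n p ^ 2) (|gN n p| ^ 3) ∂(ρ ⊗ₘ κ) =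
      (n : ℝ) * ∫ p, min ((gP n p - gN n p) ^ 2) (|gP n p - gN n p| ^ 3) ∂(ρ ⊗ₘ κ) := by
    filter_upwards [hLP, hLN] with n h1 h2
    have hi : ∀ {g : RD.Plane × ℝ → ℝ}, Measurable g → MemLp g 2 (ρ ⊗ₘ κ) →
        Integrable (fun p => min (g p ^ 2) (|g p| ^ 3)) (ρ ⊗ₘ κ) := fun hg hL => by
      refine hL.integrable_sq.mono' (by fun_prop) (ae_of_all _ fun p => ?_)
      rw [Real.norm_of_nonneg (by positivity)]
      exact min_le_left _ _
    rw [← mul_add, ← integral_add (hi (hgPm n) h1) (hi (hgNm n) h2)]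
    congr 2
    ext p
    rcases hdisj n p with h0 | h0 <;> simp [h0]
  have hL := ((RD.tendsto_score_truncated hU hcU hf hh hmodP haP hAP).add
    (RD.tendsto_score_truncated hU hcU hf hh hmodN haN hAN)).congr' hmin
  rw [add_zero] at hL
  have hmean : ∀ᶠ n in atTop, ∫ p, (gP n p - gN n p) ∂(ρ ⊗ₘ κ) = 0 := by
    filter_upwards [hLP, hLN, RD.integral_score_eq_zero hh hmodP haP hAP,
      RD.integral_score_eq_zero hh hmodN haN hAN] with n h1 h2 h3 h4
    rw [integral_sub (h1.integrable (by norm_num)) (h2.integrable (by norm_num)), h3, h4, sub_zero]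
  have hclt := RD.tendstoInDistribution_sum_triangular (P := P) hpair hRY.indep hlaws
    (g := fun n p => gP n p - gN n p) (fun n => (hgPm n).sub (hgNm n))
    (by filter_upwards [hLP, hLN] with n h1 h2 using h1.sub h2) hmean
    hV hL
  refine RD.tendstoInDistribution_of_isSmallOp_sub hclt (fun n => ?_) ?_
  · have h1 : AEMeasurable (fun ω => bPos n ω 0) P :=
      (measurable_pi_apply 0).comp_aemeasurable (hbPos.aemeasurable n)
    have h2 : AEMeasurable (fun ω => bNeg n ω 0) P :=
      (measurable_pi_apply 0).comp_aemeasurable (hbNeg.aemeasurable n)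
    exact (((h1.sub h2).sub_const _).sub_const _).const_mul _
  · have hP := RD.isSmallOp_coefError_sub hRY hρ.symm hlaw hU hcU hf hh hmodP hcdP hKl.kerPos
      hK.nonsing_pos hsP hbPos
    have hN := RD.isSmallOp_coefError_sub hRY hρ.symm hlaw hU hcU hf hh hmodN hcdN hKl.kerNeg
      hK.nonsing_neg hsN hbNeg
    refine (hP.add hN).mono (Eventually.of_forall fun n => ae_of_all _ fun ω => ?_)
    rw [RD.biasVec_congr (RD.indicator_eventuallyEq hU hcU mPos),
      RD.biasVec_congr (RD.indicator_eventuallyEq hU hcU mNeg), abs_of_nonneg (a := _ + _)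
        (add_nonneg (norm_nonneg _) (norm_nonneg _))]
    have hfst : ∀ x y : Fin 3 → ℝ, |x 0 - y 0| ≤ ‖x‖ + ‖y‖ := fun x y =>
      (norm_sub_le (x 0) (y 0)).trans (add_le_add (norm_le_pi_norm x 0) (norm_le_pi_norm y 0))
    refine le_of_eq_of_le ?_ (hfst _ _)
    simp only [Pi.sub_apply, Pi.smul_apply, smul_eq_mul, RD.inv_mulVec_sum_score]
    congr 1
    simp only [Finset.sum_sub_distrib, RD.coefError, RD.taylorCoef, RD.lin, Matrix.cons_val_zero,
      Set.indicator_of_mem hcU, RD.biasTerm, ← hgP, ← hgN, RD.effSize]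
    ring
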